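/- For an integer $N\ge 1$ let $V=\{0,1\}^{2N}$ be the $2N$-dimensional hypercube; write $|x|$ for the number of coordinates of $x\in V$ equal to $1$, and $x\sim y$ if $x$ and $y$ differ in exactly one coordinate. For $\delta\in(-1,1)$ let $K_\delta$ be the Markov kernel on $V$ given by $$K_\delta(x,y)=\begin{cases}\frac1{2N} & \text{if } x\sim y,\ |x|\ne N,\\ \frac{1+\delta}{2N} & \text{if } x\sim y,\ |x|=N,\ |y|=N+1,\\ \frac{1-\delta}{2N} & \text{if } x\sim y,\ |x|=N,\ |y|=N-1,\\ 0&\text{otherwise,}\end{cases}$$ let $Q_\delta=\frac12(I+K_\delta)$ be its lazy version, and for $\varepsilon\in(0,1)$ put $\overline{\mathcal Q}(\varepsilon)=\{Q_\delta:\delta\in[-\varepsilon,\varepsilon]\}$. For a sequence $(K_i)_{i\ge1}$ of kernels on $V$ write $K_{0,n}=K_1K_2\cdots K_n$ (with $K_{0,0}=I$), and let $$T_{\mathrm{TV}}(\eta)=\inf\Bigl\{n\ge 0:\max_{x,y\in V}\|K_{0,n}(x,\cdot)-K_{0,n}(y,\cdot)\|_{\mathrm{TV}}<\eta\Bigr\},\qquad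 \|\mu-\nu\|_{\mathrm{TV}}=\sup_{A\subset V}\{\mu(A)-\nu(A)\},$$ with $\inf\emptyset=\infty$. Write $\log_+u=\max\{0,\log u\}$, and use the conventions $0/0=1$ and $a/0=\infty$ for $a>0$. **Theorem.** For every $\varepsilon\in(0,1)$ there is a constant $D(\varepsilon)>0$, depending only on $\varepsilon$, such that for every $N\ge2$, every sequence $(K_i)_{i\ge1}$ with $K_i\in\overline{\mathcal Q}(\varepsilon)$ for all $i\ge1$, and every $\eta>0$, $$T_{\mathrm{TV}}(\eta)\le D(\varepsilon)\,N\Bigl(\log N+\log_+\frac1\eta\Bigr),$$ and $$\max_{x,y,z\in V}\left|\frac{K_{0,n}(x,z)}{K_{0,n}(y,z)}-1\right|\le\eta\qquad\text{for all } n\ge D(\varepsilon)\,N\Bigl(\log N+\log_+\frac1\eta\Bigr).$$ -/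

import Mathlib

open scoped ENNReal

noncomputable section

namespace InhomMerging

section General

variable {V : Type*} [Fintype V] [DecidableEq V]

/-- `K_{0,n} = K_1 K_2 ⋯ K_n` (with `K_{0,0} = I`) for a sequence `(K_i)_{i ≥ 1}` of kernels,
written as matrices indexed by `V`. The entry `K 0` is never used. -/
def compKernel (K : ℕ → Matrix V V ℝ) : ℕ → Matrix V V ℝ
  | 0 => 1
  | n + 1 => compKernel K n * K (n + 1)

/-- Total variation distance `sup_{A ⊆ V} (μ(A) - ν(A))`
(a supremum over a finite nonempty family). -/
def tvDist (μ ν : V → ℝ) : ℝ :=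
  ⨆ A : Finset V, ((∑ z ∈ A, μ z) - ∑ z ∈ A, ν z)

/-- `max_{x,y} ‖K_{0,n}(x,·) - K_{0,n}(y,·)‖_TV`. -/
def maxTV (K : ℕ → Matrix V V ℝ) (n : ℕ) : ℝ :=
  ⨆ p : V × V, tvDist (compKernel K n p.1) (compKernel K n p.2)

/-- The max total variation merging time
`T_TV(η) = inf {n : max_{x,y} ‖K_{0,n}(x,·) - K_{0,n}(y,·)‖_TV < η}`, with `inf ∅ = ∞`. -/
def tvMergingTime (K : ℕ → Matrix V V ℝ) (η : ℝ) : ℕ∞ :=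
  ⨅ (n : ℕ) (_ : maxTV K n < η), (n : ℕ∞)

/-- `|a / b - 1|` for `a, b ≥ 0`, with the conventions `0 / 0 = 1` and `a / 0 = ∞` for `a > 0`. -/
def relDev (a b : ℝ) : ℝ≥0∞ :=
  if b = 0 then (if a = 0 then 0 else ⊤) else ENNReal.ofReal |a / b - 1|

/-- `max_{x,y,z} |K_{0,n}(x,z) / K_{0,n}(y,z) - 1|`. -/
def maxRelDev (K : ℕ → Matrix V V ℝ) (n : ℕ) : ℝ≥0∞ :=
  ⨆ (x : V) (y : V) (z : V), relDev (compKernel K n x z) (compKernel K n y z)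

end General

/-- The `2N`-dimensional hypercube `{0,1}^{2N}`. -/
abbrev Cube (N : ℕ) : Type := Fin (2 * N) → Fin 2

/-- `|x|`, the number of coordinates of `x` equal to `1`. -/
def weight {N : ℕ} (x : Cube N) : ℕ := ∑ i, (x i : ℕ)

/-- `K_δ`: simple random walk on the hypercube with a drift `δ` on the middle level `|x| = N`.
Two vertices are neighbours when they differ in exactly one coordinate. -/
def driftKernel (N : ℕ) (δ : ℝ) : Matrix (Cube N) (Cube N) ℝ := fun x y =>
  if hammingDist x y = 1 then
    if weight x ≠ N then 1 / (2 * (N : ℝ))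
    else if weight y = N + 1 then (1 + δ) / (2 * (N : ℝ))
    else (1 - δ) / (2 * (N : ℝ))
  else 0

/-- The lazy kernel `Q_δ = (I + K_δ) / 2`. -/
def lazyDriftKernel (N : ℕ) (δ : ℝ) : Matrix (Cube N) (Cube N) ℝ :=
  (1 / 2 : ℝ) • (1 + driftKernel N δ)

/-- The family `{Q_δ : δ ∈ [-ε, ε]}`. -/
def lazyFamily (N : ℕ) (ε : ℝ) : Set (Matrix (Cube N) (Cube N) ℝ) :=
  lazyDriftKernel N '' Set.Icc (-ε) ε

end InhomMerging

end

/-!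
The kernels `Q_δ` differ from the lazy simple random walk `Q_0` only on the middle level, and all of
them act in the same way on functions of the distance to the middle level; for `Q_0` itself the
Walsh functions give the density of `Q_0 ^ n` explicitly.

On the middle level: a function which is odd under `j` disjoint exchanges of coordinates and even
in all other coordinates keeps this symmetry under every `Q_δ`, and the drift cancels between the
two coordinates of each exchanged pair, so that one step contracts the function by the factor
`1 - j / 2N`. A point mass of the middle level is a combination of such functions whose `j = 0`
part is a multiple of the indicator of the level. Hence the density of `K_{0,n}(x, ·)` is close to
`1` on the middle level after `O(N log N)` steps, for every choice of the drifts.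

Off the middle level: the density evolves as under `Q_0`, with its values on the middle level as
boundary data. The distance to the middle level is an eigenfunction of `Q_0` off that level, with
eigenvalue `1 - 1 / 2N`, and serves as a barrier both for the difference of two densities and for a
lower bound on one density.
-/

namespace InhomMerging

open Finset Matrix

section General

variable {V : Type*} [Fintype V]

theorem relDev_le_of_abs_sub_le {a b η : ℝ} (hb : 0 < b) (h : |a - b| ≤ η * b) :
    relDev a b ≤ ENNReal.ofReal η := by
  rw [relDev, if_neg hb.ne', div_sub_one hb.ne', abs_div, abs_of_pos hb]
  exact ENNReal.ofReal_le_ofReal ((div_le_iff₀ hb).2 h)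

theorem relDev_mul_left {c : ℝ} (hc : c ≠ 0) (a b : ℝ) : relDev (c * a) (c * b) = relDev a b := by
  simp only [relDev, mul_eq_zero, hc, false_or, mul_div_mul_left a b hc]

theorem abs_sub_le_of_relDev_le {a b η : ℝ} (hη : 0 ≤ η) (hb : 0 ≤ b)
    (h : relDev a b ≤ ENNReal.ofReal η) : |a - b| ≤ η * b := by
  unfold relDev at h
  split_ifs at h with hb0 ha0
  · simp [ha0, hb0]
  · exact absurd h (by simp)
  · have hb' : 0 < b := hb.lt_of_ne' hb0
    rwa [ENNReal.ofReal_le_ofReal_iff hη, div_sub_one hb0, abs_div, abs_of_pos hb',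
      div_le_iff₀ hb'] at h

theorem tvDist_le_of_relDev_le {μ ν : V → ℝ} {η : ℝ} (hη : 0 ≤ η) (hν : ∀ z, 0 ≤ ν z)
    (hsum : ∑ z, ν z = 1) (h : ∀ z, relDev (μ z) (ν z) ≤ ENNReal.ofReal η) :
    tvDist μ ν ≤ η := by
  refine ciSup_le fun A => ?_
  calc ∑ z ∈ A, μ z - ∑ z ∈ A, ν z = ∑ z ∈ A, (μ z - ν z) := (sum_sub_distrib _ _).symm
    _ ≤ ∑ z ∈ A, η * ν z := sum_le_sum fun z _ =>
        (le_abs_self _).trans (abs_sub_le_of_relDev_le hη (hν z) (h z))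
    _ ≤ ∑ z, η * ν z :=
        sum_le_sum_of_subset_of_nonneg (subset_univ A) fun z _ _ => mul_nonneg hη (hν z)
    _ = η := by rw [← mul_sum, hsum, mul_one]

variable [DecidableEq V] {K : ℕ → Matrix V V ℝ}

theorem compKernel_succ_mulVec (K : ℕ → Matrix V V ℝ) (n : ℕ) (f : V → ℝ) :
    compKernel K (n + 1) *ᵥ f = compKernel K n *ᵥ (K (n + 1) *ᵥ f) :=
  (mulVec_mulVec _ _ _).symm

theorem compKernel_mem_rowStochastic (hK : ∀ i, 1 ≤ i → K i ∈ rowStochastic ℝ V) (n : ℕ) :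
    compKernel K n ∈ rowStochastic ℝ V := by
  induction n with
  | zero => exact one_mem _
  | succ n ih => exact mul_mem ih (hK _ n.succ_pos)

theorem mul_apply_le_of_mem_rowStochastic {P M : Matrix V V ℝ} (hP : P ∈ rowStochastic ℝ V)
    {c : ℝ} {z : V} (hM : ∀ y, M y z ≤ c) (x : V) : (P * M) x z ≤ c := by
  calc (P * M) x z = ∑ y, P x y * M y z := mul_apply
    _ ≤ ∑ y, P x y * c := by
        gcongr with y
        exacts [nonneg_of_mem_rowStochastic hP, hM y]
    _ = c := by rw [← sum_mul, sum_row_of_mem_rowStochastic hP, one_mul]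

theorem maxTV_le_of_maxRelDev_le [Nonempty V] (hK : ∀ i, 1 ≤ i → K i ∈ rowStochastic ℝ V)
    {n : ℕ} {η : ℝ} (hη : 0 ≤ η) (h : maxRelDev K n ≤ ENNReal.ofReal η) : maxTV K n ≤ η := by
  have hrow := compKernel_mem_rowStochastic hK n
  refine ciSup_le fun p => tvDist_le_of_relDev_le hη
    (fun _ => nonneg_of_mem_rowStochastic hrow) (sum_row_of_mem_rowStochastic hrow _) fun z => ?_
  simp only [maxRelDev, iSup_le_iff] at h
  exact h p.1 p.2 z

theorem tvMergingTime_le {n : ℕ} {η t : ℝ} (h : maxTV K n < η) (hn : (n : ℝ) ≤ t) :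
    ((tvMergingTime K η : ℕ∞) : ENNReal) ≤ ENNReal.ofReal t := by
  calc ((tvMergingTime K η : ℕ∞) : ENNReal) ≤ ((n : ℕ∞) : ENNReal) :=
        ENat.toENNReal_le.2 (iInf₂_le n h)
    _ = ENNReal.ofReal n := by rw [ENat.toENNReal_coe, ENNReal.ofReal_natCast]
    _ ≤ ENNReal.ofReal t := ENNReal.ofReal_le_ofReal hn

end General

/-! ### Bits, flips and Walsh characters -/

/-- The real number `0` or `1` given by a coordinate of a vertex of the cube. -/
def bit (a : Fin 2) : ℝ := (a : ℕ)

/-- The sign `1` or `-1` attached to a coordinate `0` or `1` of a vertex of the cube. -/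
def spin (a : Fin 2) : ℝ := 1 - 2 * bit a

theorem bit_zero : bit 0 = 0 := by simp [bit]

theorem bit_one : bit 1 = 1 := by simp [bit]

theorem bit_eq_zero_or_one (a : Fin 2) : bit a = 0 ∨ bit a = 1 := by
  fin_cases a <;> simp [bit]

theorem bit_add_bit_of_ne {a b : Fin 2} (h : a ≠ b) : bit a + bit b = 1 := by
  fin_cases a <;> fin_cases b <;> simp_all [bit]

theorem abs_bit_sub_bit_le_one (a b : Fin 2) : |bit a - bit b| ≤ 1 := by
  fin_cases a <;> fin_cases b <;> simp [bit]

theorem bit_add_one (a : Fin 2) : bit (a + 1) = bit a + spin a := by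
  fin_cases a <;> norm_num [spin, bit]

theorem spin_add_one (a : Fin 2) : spin (a + 1) = -spin a := by
  fin_cases a <;> norm_num [spin, bit]

theorem abs_spin (a : Fin 2) : |spin a| = 1 := by
  fin_cases a <;> norm_num [spin, bit]

theorem one_add_spin_mul_spin (a b : Fin 2) :
    1 + spin a * spin b = if a = b then 2 else 0 := by
  fin_cases a <;> fin_cases b <;> norm_num [spin, bit]

section Flip

variable {ι : Type*} [DecidableEq ι]

/-- The vertex obtained from `x` by changing coordinate `i`. -/
def flipAt (i : ι) (x : ι → Fin 2) : ι → Fin 2 := Function.update x i (x i + 1)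

theorem flipAt_apply_self (i : ι) (x : ι → Fin 2) : flipAt i x i = x i + 1 :=
  Function.update_self ..

theorem flipAt_apply_of_ne {i j : ι} (h : j ≠ i) (x : ι → Fin 2) : flipAt i x j = x j :=
  Function.update_of_ne h ..

theorem flipAt_flipAt (i : ι) (x : ι → Fin 2) : flipAt i (flipAt i x) = x := by
  simp [flipAt, add_assoc]

theorem flipAt_comp (σ : Equiv.Perm ι) (x : ι → Fin 2) (i : ι) :
    flipAt i (x ∘ σ) = flipAt (σ i) x ∘ σ := by
  simp [flipAt, Function.update_comp_equiv]

theorem flipAt_injective (x : ι → Fin 2) : Function.Injective fun i => flipAt i x := by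
  intro i j h
  by_contra hij
  have := congrFun h i
  simp [flipAt_apply_self, flipAt_apply_of_ne hij] at this

variable [Fintype ι]

theorem hammingDist_eq_one_iff {x y : ι → Fin 2} :
    hammingDist x y = 1 ↔ ∃ i, flipAt i x = y := by
  have flip_iff : ∀ a b : Fin 2, a ≠ b ↔ b = a + 1 := by decide
  refine card_eq_one.trans (exists_congr fun i => ?_)
  simp only [Finset.ext_iff, mem_filter_univ, mem_singleton, funext_iff, flipAt,
    Function.update_apply]
  refine forall_congr' fun j => ?_
  split_ifs with h
  · simp [h, flip_iff, eq_comm]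
  · simp [h]

theorem sum_eq_sum_flipAt (x : ι → Fin 2) {φ : (ι → Fin 2) → ℝ}
    (h : ∀ y, hammingDist x y ≠ 1 → φ y = 0) : ∑ y, φ y = ∑ i, φ (flipAt i x) := by
  rw [← sum_image (f := φ) (flipAt_injective x).injOn]
  refine (sum_subset (subset_univ _) fun y _ hy => h y fun hxy => hy ?_).symm
  simpa using hammingDist_eq_one_iff.1 hxy

end Flip

section Walsh

variable {ι : Type*}

/-- The Walsh character of the cube indexed by the set `A` of coordinates. -/
def walsh (A : Finset ι) (x : ι → Fin 2) : ℝ := ∏ i ∈ A, spin (x i)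

theorem abs_walsh (A : Finset ι) (x : ι → Fin 2) : |walsh A x| = 1 := by
  rw [walsh, abs_prod]
  exact prod_eq_one fun i _ => abs_spin (x i)

theorem walsh_flipAt [DecidableEq ι] (A : Finset ι) (i : ι) (x : ι → Fin 2) :
    walsh A (flipAt i x) = if i ∈ A then -walsh A x else walsh A x := by
  have hoff : ∀ B : Finset ι, i ∉ B → walsh B (flipAt i x) = walsh B x := fun B hi =>
    prod_congr rfl fun j hj => by rw [flipAt_apply_of_ne (ne_of_mem_of_not_mem hj hi)]
  split_ifs with hi
  · have hA : ∀ y : ι → Fin 2, walsh A y = spin (y i) * walsh (A.erase i) y :=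
      fun y => (mul_prod_erase A (fun i => spin (y i)) hi).symm
    rw [hA, hA, hoff _ (notMem_erase i A), flipAt_apply_self, spin_add_one, neg_mul]
  · exact hoff A hi

variable [Fintype ι]

theorem sum_walsh_flipAt [DecidableEq ι] (A : Finset ι) (x : ι → Fin 2) :
    ∑ i, walsh A (flipAt i x) = (Fintype.card ι - 2 * #A) * walsh A x := by
  have h : ∀ i, walsh A (flipAt i x) = walsh A x - if i ∈ A then 2 * walsh A x else 0 := by
    intro i
    rw [walsh_flipAt]
    split_ifs <;> ring
  simp only [h, sum_sub_distrib, sum_ite_mem, univ_inter, sum_const, nsmul_eq_mul, card_univ]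
  ring

theorem sum_walsh_mul_walsh (x z : ι → Fin 2) :
    ∑ A, walsh A z * walsh A x = if x = z then 2 ^ Fintype.card ι else 0 := by
  calc ∑ A, walsh A z * walsh A x = ∏ i, (1 + spin (z i) * spin (x i)) := by
        rw [prod_one_add, powerset_univ]
        exact sum_congr rfl fun A _ => prod_mul_distrib.symm
    _ = ∏ i, if z i = x i then 2 else 0 := by simp only [one_add_spin_mul_spin]
    _ = if x = z then 2 ^ Fintype.card ι else 0 := by
        rw [prod_ite_zero]
        simp [← funext_iff, eq_comm, card_univ]

end Walsh

/-! ### The lazy walk -/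

variable {N : ℕ}

theorem weight_eq_sum_bit (x : Cube N) : (weight x : ℝ) = ∑ i, bit (x i) := by
  simp [weight, bit]

theorem weight_eq_card (x : Cube N) : weight x = #{i | x i = 1} := by
  have h : ∀ a : Fin 2, (a : ℕ) = if a = 1 then 1 else 0 := by decide
  simp only [weight, h, card_filter]

theorem weight_comp (σ : Equiv.Perm (Fin (2 * N))) (x : Cube N) : weight (x ∘ σ) = weight x :=
  Equiv.sum_comp σ fun i => (x i : ℕ)

theorem weight_flipAt (i : Fin (2 * N)) (x : Cube N) :
    (weight (flipAt i x) : ℝ) = weight x + spin (x i) := by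
  rw [weight_eq_sum_bit, weight_eq_sum_bit, ← add_sum_erase _ _ (mem_univ i),
    ← add_sum_erase univ (fun i => bit (x i)) (mem_univ i),
    sum_congr rfl fun j hj => by rw [flipAt_apply_of_ne (ne_of_mem_erase hj)],
    flipAt_apply_self, bit_add_one, add_right_comm]

theorem sum_spin (x : Cube N) : ∑ i, spin (x i) = 2 * (N - weight x) := by
  simp only [spin, sum_sub_distrib, ← mul_sum, ← weight_eq_sum_bit, sum_const, card_univ,
    Fintype.card_fin, nsmul_eq_mul, mul_one]
  push_cast
  ring

/-- The rate at which the walk with drift `δ` flips coordinate `i` of `x`, relative to the rate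
of the simple random walk. -/
def flipRate (δ : ℝ) (x : Cube N) (i : Fin (2 * N)) : ℝ :=
  if weight x = N then 1 + δ * spin (x i) else 1

theorem flipRate_zero (x : Cube N) (i : Fin (2 * N)) : flipRate 0 x i = 1 := by
  simp [flipRate]

theorem flipRate_of_weight_ne {x : Cube N} (h : weight x ≠ N) (δ : ℝ) (i : Fin (2 * N)) :
    flipRate δ x i = 1 :=
  if_neg h

theorem flipRate_mem_Icc {δ ε : ℝ} (hε : 0 ≤ ε) (hδ : δ ∈ Set.Icc (-ε) ε) (x : Cube N)
    (i : Fin (2 * N)) : flipRate δ x i ∈ Set.Icc (1 - ε) (1 + ε) := by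
  have h : |δ * spin (x i)| ≤ ε := by rwa [abs_mul, abs_spin, mul_one, abs_le]
  obtain ⟨h₁, h₂⟩ := abs_le.1 h
  unfold flipRate
  split_ifs <;> constructor <;> linarith

theorem flipRate_nonneg {δ : ℝ} (hδ : δ ∈ Set.Icc (-1) 1) (x : Cube N) (i : Fin (2 * N)) :
    0 ≤ flipRate δ x i := by
  simpa using (flipRate_mem_Icc zero_le_one hδ x i).1

theorem flipRate_comp (δ : ℝ) (σ : Equiv.Perm (Fin (2 * N))) (x : Cube N) (i : Fin (2 * N)) :
    flipRate δ (x ∘ σ) i = flipRate δ x (σ i) := by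
  simp [flipRate, weight_comp]

theorem sum_flipRate (δ : ℝ) (x : Cube N) : ∑ i, flipRate δ x i = 2 * N := by
  unfold flipRate
  split_ifs with h
  · simp [sum_add_distrib, ← mul_sum, sum_spin, h]
  · simp

theorem flipRate_add_flipRate_of_ne (δ : ℝ) {x : Cube N} {i k : Fin (2 * N)} (h : x i ≠ x k) :
    flipRate δ x i + flipRate δ x k = 2 := by
  unfold flipRate spin
  split_ifs
  · linear_combination (-2 * δ) * bit_add_bit_of_ne h
  · norm_num

theorem driftKernel_flipAt (δ : ℝ) (i : Fin (2 * N)) (x : Cube N) :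
    driftKernel N δ x (flipAt i x) = flipRate δ x i / (2 * N) := by
  unfold driftKernel flipRate
  rw [if_pos (hammingDist_eq_one_iff.2 ⟨i, rfl⟩)]
  by_cases h : weight x = N
  · have hw : weight (flipAt i x) = N + 1 ↔ (1 : ℝ) = spin (x i) := by
      rw [← Nat.cast_inj (R := ℝ), weight_flipAt, h]
      push_cast
      rw [add_right_inj, eq_comm]
    rcases bit_eq_zero_or_one (x i) with hb | hb <;> norm_num [h, hw, spin, hb]
    ring
  · simp [h]

theorem driftKernel_eq_zero (δ : ℝ) {x y : Cube N} (h : hammingDist x y ≠ 1) :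
    driftKernel N δ x y = 0 :=
  if_neg h

theorem lazyDriftKernel_mulVec (δ : ℝ) (f : Cube N → ℝ) (x : Cube N) :
    (lazyDriftKernel N δ *ᵥ f) x =
      1 / 2 * f x + 1 / (4 * N) * ∑ i, flipRate δ x i * f (flipAt i x) := by
  have h : (driftKernel N δ *ᵥ f) x = ∑ i, flipRate δ x i / (2 * N) * f (flipAt i x) := by
    simp only [mulVec, dotProduct, ← driftKernel_flipAt]
    exact sum_eq_sum_flipAt x fun y hy => by rw [driftKernel_eq_zero δ hy, zero_mul]
  rw [lazyDriftKernel, smul_mulVec, add_mulVec, one_mulVec, Pi.smul_apply, Pi.add_apply, h,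
    smul_eq_mul, mul_add, mul_sum, mul_sum]
  congr 1
  exact sum_congr rfl fun i _ => by ring

theorem vecMul_lazyDriftKernel (δ : ℝ) (f : Cube N → ℝ) (z : Cube N) :
    (f ᵥ* lazyDriftKernel N δ) z =
      1 / 2 * f z + 1 / (4 * N) * ∑ i, flipRate δ (flipAt i z) i * f (flipAt i z) := by
  have h : (f ᵥ* driftKernel N δ) z =
      ∑ i, flipRate δ (flipAt i z) i / (2 * N) * f (flipAt i z) := by
    rw [vecMul, dotProduct, sum_eq_sum_flipAt z fun y hy => by
      rw [driftKernel_eq_zero δ (hammingDist_comm y z ▸ hy), mul_zero]]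
    refine sum_congr rfl fun i _ => ?_
    rw [← driftKernel_flipAt, flipAt_flipAt, mul_comm]
  rw [lazyDriftKernel, vecMul_smul, vecMul_add, vecMul_one, Pi.smul_apply, Pi.add_apply, h,
    smul_eq_mul, mul_add, mul_sum, mul_sum]
  congr 1
  exact sum_congr rfl fun i _ => by ring

theorem lazyDriftKernel_zero_mulVec (f : Cube N → ℝ) (x : Cube N) :
    (lazyDriftKernel N 0 *ᵥ f) x = 1 / 2 * f x + 1 / (4 * N) * ∑ i, f (flipAt i x) := by
  simp only [lazyDriftKernel_mulVec, flipRate_zero, one_mul]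

theorem vecMul_lazyDriftKernel_zero (f : Cube N → ℝ) :
    f ᵥ* lazyDriftKernel N 0 = lazyDriftKernel N 0 *ᵥ f := by
  ext z
  simp only [vecMul_lazyDriftKernel, lazyDriftKernel_zero_mulVec, flipRate_zero, one_mul]

theorem lazyDriftKernel_mulVec_comp (δ : ℝ) (σ : Equiv.Perm (Fin (2 * N))) (f : Cube N → ℝ)
    (x : Cube N) :
    (lazyDriftKernel N δ *ᵥ f) (x ∘ σ) = (lazyDriftKernel N δ *ᵥ fun y => f (y ∘ σ)) x := by
  simp only [lazyDriftKernel_mulVec, flipAt_comp, flipRate_comp]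
  rw [Equiv.sum_comp σ fun i => flipRate δ x i * f (flipAt i x ∘ σ)]

theorem lazyDriftKernel_mem_rowStochastic (hN : 0 < N) {δ : ℝ} (hδ : δ ∈ Set.Icc (-1) 1) :
    lazyDriftKernel N δ ∈ rowStochastic ℝ (Cube N) := by
  refine ⟨fun x y => ?_, funext fun x => ?_⟩
  · have hsingle : (0 : Cube N → ℝ) ≤ Pi.single y 1 := Pi.single_nonneg.2 zero_le_one
    rw [show lazyDriftKernel N δ x y = (lazyDriftKernel N δ *ᵥ Pi.single y 1) x by simp,
      lazyDriftKernel_mulVec]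
    exact add_nonneg (mul_nonneg (by norm_num) (hsingle x)) <| mul_nonneg (by positivity) <|
      sum_nonneg fun i _ => mul_nonneg (flipRate_nonneg hδ x i) (hsingle _)
  · have : (N : ℝ) ≠ 0 := by positivity
    simp only [lazyDriftKernel_mulVec, Pi.one_apply, mul_one, sum_flipRate]
    field_simp
    norm_num

theorem mem_rowStochastic_of_mem_lazyFamily (hN : 0 < N) {ε : ℝ} (hε : ε ≤ 1)
    {Q : Matrix (Cube N) (Cube N) ℝ} (hQ : Q ∈ lazyFamily N ε) :
    Q ∈ rowStochastic ℝ (Cube N) := by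
  obtain ⟨δ, hδ, rfl⟩ := hQ
  exact lazyDriftKernel_mem_rowStochastic hN (Set.Icc_subset_Icc (neg_le_neg hε) hε hδ)

/-! ### Mixing of the simple random walk -/

/-- The factor by which `n` steps of the lazy walk damp a function of a single coordinate. -/
noncomputable def damping (N n : ℕ) : ℝ := Real.exp (-n / (2 * N))

theorem damping_pos (N n : ℕ) : 0 < damping N n := Real.exp_pos _

theorem one_sub_div_nonneg {j : ℕ} (hj : j ≤ 2 * N) : 0 ≤ 1 - (j : ℝ) / (2 * N) :=
  sub_nonneg.2 <| div_le_one_of_le₀ (by exact_mod_cast hj) (by positivity)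

theorem one_sub_div_pow_le_damping_pow {j : ℕ} (hj : j ≤ 2 * N) (n : ℕ) :
    (1 - (j : ℝ) / (2 * N)) ^ n ≤ damping N n ^ j := by
  calc (1 - (j : ℝ) / (2 * N)) ^ n ≤ Real.exp (-((j : ℝ) / (2 * N))) ^ n :=
        pow_le_pow_left₀ (one_sub_div_nonneg hj) (Real.one_sub_le_exp_neg _) n
    _ = damping N n ^ j := by
        rw [damping, ← Real.exp_nat_mul, ← Real.exp_nat_mul]
        ring_nf

theorem lazyDriftKernel_zero_mulVec_walsh (hN : 0 < N) (A : Finset (Fin (2 * N))) :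
    lazyDriftKernel N 0 *ᵥ walsh A = (1 - (#A : ℝ) / (2 * N)) • walsh A := by
  ext x
  have : (N : ℝ) ≠ 0 := by positivity
  rw [lazyDriftKernel_zero_mulVec, sum_walsh_flipAt, Fintype.card_fin, Pi.smul_apply, smul_eq_mul]
  field_simp
  push_cast
  ring

theorem pow_lazyDriftKernel_zero_mulVec_walsh (hN : 0 < N) (n : ℕ) (A : Finset (Fin (2 * N))) :
    lazyDriftKernel N 0 ^ n *ᵥ walsh A = (1 - (#A : ℝ) / (2 * N)) ^ n • walsh A := by
  induction n with
  | zero => simp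
  | succ n ih =>
    rw [pow_succ, ← mulVec_mulVec, lazyDriftKernel_zero_mulVec_walsh hN, mulVec_smul, ih,
      smul_smul, pow_succ']

theorem four_pow_mul_pow_lazyDriftKernel_zero_apply (hN : 0 < N) (n : ℕ) (x z : Cube N) :
    4 ^ N * (lazyDriftKernel N 0 ^ n) x z =
      ∑ A, (1 - (#A : ℝ) / (2 * N)) ^ n * (walsh A z * walsh A x) := by
  have hsingle : (4 : ℝ) ^ N • Pi.single z (1 : ℝ) = ∑ A, walsh A z • walsh A := by
    ext y
    have h4 : (4 : ℝ) ^ N = 2 ^ Fintype.card (Fin (2 * N)) := by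
      rw [Fintype.card_fin, pow_mul]
      norm_num
    simp [sum_walsh_mul_walsh, Pi.single_apply, h4]
  calc 4 ^ N * (lazyDriftKernel N 0 ^ n) x z
      = (lazyDriftKernel N 0 ^ n *ᵥ ((4 : ℝ) ^ N • Pi.single z (1 : ℝ))) x := by
        simp [mulVec_smul]
    _ = ∑ A, (1 - (#A : ℝ) / (2 * N)) ^ n * (walsh A z * walsh A x) := by
        rw [hsingle, mulVec_sum, Finset.sum_apply]
        refine sum_congr rfl fun A _ => ?_
        rw [mulVec_smul, pow_lazyDriftKernel_zero_mulVec_walsh hN, Pi.smul_apply, Pi.smul_apply,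
          smul_eq_mul, smul_eq_mul, mul_left_comm]

theorem abs_four_pow_mul_pow_lazyDriftKernel_zero_sub_one_le (hN : 0 < N) (n : ℕ)
    (x z : Cube N) :
    |4 ^ N * (lazyDriftKernel N 0 ^ n) x z - 1| ≤ (1 + damping N n) ^ (2 * N) - 1 := by
  have hbinom : ∑ A : Finset (Fin (2 * N)), damping N n ^ #A = (1 + damping N n) ^ (2 * N) := by
    simpa [add_comm] using Fintype.sum_pow_mul_eq_add_pow (Fin (2 * N)) (damping N n) 1
  rw [four_pow_mul_pow_lazyDriftKernel_zero_apply hN, ← hbinom,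
    ← add_sum_erase _ _ (mem_univ ∅), ← add_sum_erase _ (fun A => damping N n ^ #A) (mem_univ ∅)]
  simp only [card_empty, CharP.cast_eq_zero, zero_div, sub_zero, one_pow, walsh, prod_empty,
    mul_one, pow_zero, add_sub_cancel_left]
  refine (abs_sum_le_sum_abs _ _).trans (sum_le_sum fun A _ => ?_)
  have hA : #A ≤ 2 * N := by simpa using card_le_univ A
  calc |(1 - (#A : ℝ) / (2 * N)) ^ n * (walsh A z * walsh A x)|
      = (1 - (#A : ℝ) / (2 * N)) ^ n := by
        rw [abs_mul, abs_mul, abs_walsh, abs_walsh, mul_one, mul_one,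
          abs_of_nonneg (pow_nonneg (one_sub_div_nonneg hA) n)]
    _ ≤ damping N n ^ #A := one_sub_div_pow_le_damping_pow hA n

/-! ### Functions of the distance to the middle level -/

/-- The distance between a vertex and the middle level of the cube. -/
def midDist (x : Cube N) : ℝ := |(weight x : ℝ) - N|

/-- The indicator function of the middle level. -/
def midIndicator (N : ℕ) (x : Cube N) : ℝ := if weight x = N then 1 else 0

theorem midDist_nonneg (x : Cube N) : 0 ≤ midDist x := abs_nonneg _

theorem midDist_eq_zero {x : Cube N} : midDist x = 0 ↔ weight x = N := by
  rw [midDist, abs_eq_zero, sub_eq_zero, Nat.cast_inj]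

theorem one_le_midDist {x : Cube N} (h : weight x ≠ N) : 1 ≤ midDist x := by
  have h1 : (1 : ℤ) ≤ |(weight x : ℤ) - (N : ℤ)| :=
    Int.one_le_abs (sub_ne_zero.2 (by exact_mod_cast h))
  have h2 : ((1 : ℤ) : ℝ) ≤ (|(weight x : ℤ) - (N : ℤ)| : ℤ) := Int.cast_le.2 h1
  simpa [midDist] using h2

theorem midDist_le (x : Cube N) : midDist x ≤ N := by
  have : weight x ≤ 2 * N := by
    rw [weight_eq_card]
    exact (card_filter_le _ _).trans (by simp)
  have : (weight x : ℝ) ≤ 2 * N := by exact_mod_cast this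
  exact abs_le.2 ⟨by linarith [(weight x).cast_nonneg (α := ℝ)], by linarith⟩

theorem midDist_flipAt (i : Fin (2 * N)) (x : Cube N) :
    midDist (flipAt i x) = |(weight x - N) + spin (x i)| := by
  rw [midDist, weight_flipAt, sub_add_eq_add_sub]

theorem sum_comp_spin (x : Cube N) (F : ℝ → ℝ) :
    ∑ i, F (spin (x i)) = (N - (weight x - N)) * F 1 + (N + (weight x - N)) * F (-1) := by
  have h : ∀ i, F (spin (x i)) = F 1 + bit (x i) * (F (-1) - F 1) := by
    intro i
    rcases bit_eq_zero_or_one (x i) with h | h <;> norm_num [spin, h]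
  simp only [h, sum_add_distrib, ← sum_mul, ← weight_eq_sum_bit, sum_const, card_univ,
    Fintype.card_fin, nsmul_eq_mul]
  push_cast
  ring

theorem sum_comp_midDist_flipAt (c : ℝ → ℝ) (x : Cube N) :
    ∑ i, c (midDist (flipAt i x)) =
      (N - midDist x) * c (midDist x + 1) + (N + midDist x) * c |midDist x - 1| := by
  simp only [midDist_flipAt]
  rw [sum_comp_spin x fun s => c |weight x - N + s|, midDist]
  rcases le_total 0 ((weight x : ℝ) - N) with h | h
  · rw [abs_of_nonneg h, abs_of_nonneg (by linarith : 0 ≤ (weight x : ℝ) - N + 1), sub_eq_add_neg]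
    rfl
  · rw [abs_of_nonpos h, abs_of_nonpos (by linarith : (weight x : ℝ) - N + -1 ≤ 0),
      ← abs_neg (-((weight x : ℝ) - N) - 1)]
    ring_nf

theorem lazyDriftKernel_mulVec_comp_midDist (δ : ℝ) (c : ℝ → ℝ) :
    lazyDriftKernel N δ *ᵥ (c ∘ midDist) = lazyDriftKernel N 0 *ᵥ (c ∘ midDist) := by
  ext x
  rw [lazyDriftKernel_mulVec, lazyDriftKernel_zero_mulVec]
  congr 2
  by_cases hx : weight x = N
  · have h : ∀ i, (c ∘ midDist) (flipAt i x) = c 1 := by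
      intro i
      rw [Function.comp_apply, midDist_flipAt, hx, sub_self, zero_add, abs_spin]
    simp only [h, ← sum_mul, sum_flipRate]
    simp
  · simp only [flipRate_of_weight_ne hx, one_mul]

theorem exists_lazyDriftKernel_zero_mulVec_comp_midDist (c : ℝ → ℝ) :
    ∃ c' : ℝ → ℝ, lazyDriftKernel N 0 *ᵥ (c ∘ midDist) = c' ∘ midDist :=
  ⟨fun d => 1 / 2 * c d + 1 / (4 * N) * ((N - d) * c (d + 1) + (N + d) * c |d - 1|),
    funext fun x => by
      simp only [lazyDriftKernel_zero_mulVec, Function.comp_apply, sum_comp_midDist_flipAt]⟩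

theorem compKernel_mulVec_comp_midDist {K : ℕ → Matrix (Cube N) (Cube N) ℝ}
    (hK : ∀ i, 1 ≤ i → K i ∈ Set.range (lazyDriftKernel N)) (n : ℕ) (c : ℝ → ℝ) :
    compKernel K n *ᵥ (c ∘ midDist) = lazyDriftKernel N 0 ^ n *ᵥ (c ∘ midDist) := by
  induction n generalizing c with
  | zero => rfl
  | succ n ih =>
    obtain ⟨δ, hδ⟩ := hK (n + 1) n.succ_pos
    obtain ⟨c', hc'⟩ := exists_lazyDriftKernel_zero_mulVec_comp_midDist (N := N) c
    rw [compKernel_succ_mulVec, ← hδ, lazyDriftKernel_mulVec_comp_midDist, hc', ih, ← hc',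
      mulVec_mulVec, pow_succ]

theorem midIndicator_eq_comp_midDist :
    midIndicator N = (fun d => if d = 0 then 1 else 0) ∘ midDist := by
  ext x
  simp only [midIndicator, Function.comp_apply, midDist_eq_zero]

theorem card_weight_eq : #{x : Cube N | weight x = N} = (2 * N).choose N := by
  calc #{x : Cube N | weight x = N} = #(powersetCard N (univ : Finset (Fin (2 * N)))) := by
        refine card_nbij' (fun x => ({i | x i = 1} : Finset _))
          (fun T i => if i ∈ T then 1 else 0) ?_ ?_ ?_ ?_
        · intro x hx
          simpa [mem_powersetCard, weight_eq_card] using hx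
        · intro T hT
          simpa [mem_powersetCard, weight_eq_card] using hT
        · intro x _
          ext i : 1
          have : x i = 0 ∨ x i = 1 := by generalize x i = a; revert a; decide
          rcases this with h | h <;> simp [h]
        · intro T _
          simp
    _ = (2 * N).choose N := by simp [card_powersetCard]

theorem sum_midIndicator : ∑ x, midIndicator N x = (2 * N).choose N := by
  simp only [midIndicator, sum_boole, card_weight_eq]

theorem abs_four_pow_mul_compKernel_mulVec_midIndicator_sub_le (hN : 0 < N)
    {K : ℕ → Matrix (Cube N) (Cube N) ℝ} (hK : ∀ i, 1 ≤ i → K i ∈ Set.range (lazyDriftKernel N))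
    (n : ℕ) (x : Cube N) :
    |4 ^ N * (compKernel K n *ᵥ midIndicator N) x - (2 * N).choose N| ≤
      (2 * N).choose N * ((1 + damping N n) ^ (2 * N) - 1) := by
  rw [midIndicator_eq_comp_midDist, compKernel_mulVec_comp_midDist hK,
    ← midIndicator_eq_comp_midDist, ← sum_midIndicator, mulVec, dotProduct, mul_sum,
    ← sum_sub_distrib, sum_mul]
  refine (abs_sum_le_sum_abs _ _).trans (sum_le_sum fun z _ => ?_)
  have h0 : 0 ≤ midIndicator N z := by unfold midIndicator; positivity
  rw [← mul_assoc, mul_comm _ (midIndicator N z), ← mul_sub_one, abs_mul, abs_of_nonneg h0]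
  exact mul_le_mul_of_nonneg_left
    (abs_four_pow_mul_pow_lazyDriftKernel_zero_sub_one_le hN n x z) h0

/-! ### Damping of functions that are odd under disjoint exchanges of coordinates -/

section Odd

variable {ι : Type*} [DecidableEq ι]

/-- `g` changes sign when the values of the coordinates `i` and `τ i` are exchanged, for every
coordinate `i` moved by `τ`. This is used for involutions `τ`, whose transpositions are then the
exchanges under which `g` is odd. -/
def IsOddUnder (τ : Equiv.Perm ι) (g : (ι → Fin 2) → ℝ) : Prop :=
  ∀ i, τ i ≠ i → ∀ x, g (x ∘ Equiv.swap i (τ i)) = -g x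

namespace IsOddUnder

variable {σ τ : Equiv.Perm ι} {g : (ι → Fin 2) → ℝ} {i : ι} {x : ι → Fin 2}

theorem mul (hστ : σ.Disjoint τ) (hσ : IsOddUnder σ g) (hτ : IsOddUnder τ g) :
    IsOddUnder (σ * τ) g := by
  intro i hi x
  rcases hστ i with h | h
  · have : (σ * τ) i = τ i := by rw [hστ.commute.eq, Equiv.Perm.mul_apply, h]
    exact this ▸ hτ i (this ▸ hi) x
  · have : (σ * τ) i = σ i := by rw [Equiv.Perm.mul_apply, h]
    exact this ▸ hσ i (this ▸ hi) x

theorem eq_zero (hg : IsOddUnder τ g) (hi : τ i ≠ i) (hx : x i = x (τ i)) : g x = 0 := by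
  have h := hg i hi x
  rw [Equiv.comp_swap_eq_update, hx, Function.update_eq_self, ← hx,
    Function.update_eq_self] at h
  exact self_eq_neg.1 h

theorem apply_flipAt_eq_zero (hg : IsOddUnder τ g) (hi : τ i ≠ i) (hx : x i ≠ x (τ i)) :
    g (flipAt i x) = 0 := by
  refine hg.eq_zero hi ?_
  have h : ∀ a b : Fin 2, a ≠ b → a + 1 = b := by decide
  rw [flipAt_apply_self, flipAt_apply_of_ne hi, h _ _ hx]

end IsOddUnder

theorem sum_support_of_involutive [Fintype ι] {τ : Equiv.Perm ι} (hτ : Function.Involutive τ)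
    {f : ι → ℝ} {c : ℝ} (hf : ∀ i, τ i ≠ i → f i + f (τ i) = 2 * c) :
    ∑ i ∈ τ.support, f i = #τ.support * c := by
  have hmap : ∑ i ∈ τ.support, f (τ i) = ∑ i ∈ τ.support, f i :=
    sum_nbij' τ τ (by simp) (by simp) (fun i _ => hτ i) (fun i _ => hτ i) (fun _ _ => rfl)
  have hpair : ∑ i ∈ τ.support, (f i + f (τ i)) = #τ.support * (2 * c) := by
    rw [sum_congr rfl fun i hi => hf i (Equiv.Perm.mem_support.1 hi), sum_const, nsmul_eq_mul]
  rw [sum_add_distrib, hmap] at hpair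
  linarith

end Odd

namespace IsOddUnder

variable {τ : Equiv.Perm (Fin (2 * N))} {g : Cube N → ℝ}

theorem lazyDriftKernel_mulVec (hg : IsOddUnder τ g) (δ : ℝ) :
    IsOddUnder τ (lazyDriftKernel N δ *ᵥ g) := by
  intro i hi x
  rw [lazyDriftKernel_mulVec_comp, show (fun y => g (y ∘ Equiv.swap i (τ i))) = -g from
    funext (hg i hi), mulVec_neg, Pi.neg_apply]

theorem abs_sum_flipRate_mul_le (hg : IsOddUnder τ g) (hτ : Function.Involutive τ) {δ : ℝ}
    (hδ : δ ∈ Set.Icc (-1) 1) {B : ℝ} (hB : ∀ x, |g x| ≤ B) {x : Cube N}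
    (hx : ∀ i, τ i ≠ i → x i ≠ x (τ i)) :
    |∑ i, flipRate δ x i * g (flipAt i x)| ≤ (2 * N - #τ.support) * B := by
  have hsupp : ∑ i ∈ τ.support, flipRate δ x i * g (flipAt i x) = 0 := sum_eq_zero fun i hi => by
    have hi' := Equiv.Perm.mem_support.1 hi
    rw [hg.apply_flipAt_eq_zero hi' (hx i hi'), mul_zero]
  have hrate : ∑ i ∈ τ.supportᶜ, flipRate δ x i = 2 * N - #τ.support := by
    rw [eq_sub_iff_add_eq', ← sum_flipRate δ x, ← sum_add_sum_compl τ.support,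
      sum_support_of_involutive hτ (c := 1) fun i hi => by
        rw [flipRate_add_flipRate_of_ne δ (hx i hi), mul_one], mul_one]
  rw [← sum_add_sum_compl τ.support, hsupp, zero_add, ← hrate, sum_mul]
  refine (abs_sum_le_sum_abs _ _).trans (sum_le_sum fun i _ => ?_)
  rw [abs_mul, abs_of_nonneg (flipRate_nonneg hδ x i)]
  exact mul_le_mul_of_nonneg_left (hB _) (flipRate_nonneg hδ x i)

theorem abs_lazyDriftKernel_mulVec_le (hN : 0 < N) (hg : IsOddUnder τ g)
    (hτ : Function.Involutive τ) {j : ℕ} (hj : #τ.support = 2 * j) {δ : ℝ}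
    (hδ : δ ∈ Set.Icc (-1) 1) {B : ℝ} (hB : ∀ x, |g x| ≤ B) (x : Cube N) :
    |(lazyDriftKernel N δ *ᵥ g) x| ≤ (1 - j / (2 * N)) * B := by
  by_cases hx : ∀ i, τ i ≠ i → x i ≠ x (τ i)
  · have hsum := hg.abs_sum_flipRate_mul_le hτ hδ hB hx
    rw [hj] at hsum
    calc |(lazyDriftKernel N δ *ᵥ g) x|
        ≤ 1 / 2 * |g x| + 1 / (4 * N) * |∑ i, flipRate δ x i * g (flipAt i x)| := by
          rw [InhomMerging.lazyDriftKernel_mulVec]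
          refine (abs_add_le _ _).trans_eq ?_
          rw [abs_mul, abs_mul, abs_of_nonneg (by positivity : (0 : ℝ) ≤ 1 / 2),
            abs_of_nonneg (by positivity : (0 : ℝ) ≤ 1 / (4 * N))]
      _ ≤ 1 / 2 * B + 1 / (4 * N) * ((2 * N - (2 * j : ℕ)) * B) := by
          gcongr
          exact hB x
      _ = (1 - j / (2 * N)) * B := by
          field_simp
          push_cast
          ring
  · push Not at hx
    obtain ⟨i, hi, hxi⟩ := hx
    rw [(hg.lazyDriftKernel_mulVec δ).eq_zero hi hxi, abs_zero]
    have hjN : 2 * j ≤ 2 * N := hj ▸ (card_le_univ _).trans (Fintype.card_fin _).le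
    exact mul_nonneg (one_sub_div_nonneg (by lia)) ((abs_nonneg _).trans (hB x))

theorem abs_compKernel_mulVec_le (hN : 0 < N) {K : ℕ → Matrix (Cube N) (Cube N) ℝ}
    (hK : ∀ i, 1 ≤ i → K i ∈ lazyFamily N 1) (hg : IsOddUnder τ g) (hτ : Function.Involutive τ)
    {j : ℕ} (hj : #τ.support = 2 * j) {B : ℝ} (hB : ∀ x, |g x| ≤ B) (n : ℕ) (x : Cube N) :
    |(compKernel K n *ᵥ g) x| ≤ (1 - j / (2 * N)) ^ n * B := by
  induction n generalizing g B with
  | zero => simpa [compKernel] using hB x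
  | succ n ih =>
    obtain ⟨δ, hδ, hKδ⟩ := hK (n + 1) n.succ_pos
    rw [compKernel_succ_mulVec, ← hKδ, pow_succ, mul_assoc]
    exact ih (hg.lazyDriftKernel_mulVec δ) (hg.abs_lazyDriftKernel_mulVec_le hN hτ hj hδ hB)

end IsOddUnder

/-- A function on the middle level which is odd under the exchanges of coordinates given by the
involution `τ` with `j` transpositions, and even under the exchanges of the other coordinates. -/
structure IsPairFunction (j : ℕ) (τ : Equiv.Perm (Fin (2 * N))) (g : Cube N → ℝ) : Prop where
  card_support : #τ.support = 2 * j
  involutive : Function.Involutive τ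
  odd : IsOddUnder τ g
  even : ∀ i k, τ i = i → τ k = k → ∀ x, g (x ∘ Equiv.swap i k) = g x
  eq_zero_of_weight_ne : ∀ x, weight x ≠ N → g x = 0
  abs_le_one : ∀ x, |g x| ≤ 1

theorem isPairFunction_midIndicator : IsPairFunction 0 1 (midIndicator N) where
  card_support := by simp
  involutive _ := rfl
  odd i hi := absurd rfl hi
  even i k _ _ x := by simp [midIndicator, weight_comp]
  eq_zero_of_weight_ne x hx := if_neg hx
  abs_le_one x := by unfold midIndicator; split_ifs <;> simp

/-- The function obtained from `g` by pairing two further coordinates `i` and `k`. -/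
noncomputable def pairExtend (g : Cube N → ℝ) (i k : Fin (2 * N)) : Cube N → ℝ :=
  fun x => g x * (bit (x i) - bit (x k))

namespace IsPairFunction

variable {j : ℕ} {τ : Equiv.Perm (Fin (2 * N))} {g : Cube N → ℝ} {i k : Fin (2 * N)}

theorem isOddUnder_swap_pairExtend (hg : IsPairFunction j τ g) (hi : τ i = i) (hk : τ k = k) :
    IsOddUnder (Equiv.swap i k) (pairExtend g i k) := by
  have h : ∀ x, pairExtend g i k (x ∘ Equiv.swap i k) = -pairExtend g i k x := by
    intro x
    simp only [pairExtend, hg.even i k hi hk, Function.comp_apply, Equiv.swap_apply_left,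
      Equiv.swap_apply_right]
    ring
  intro l hl x
  obtain ⟨-, rfl | rfl⟩ := Equiv.swap_apply_ne_self_iff.1 hl
  · rw [Equiv.swap_apply_left, h]
  · rw [Equiv.swap_apply_right, Equiv.swap_comm, h]

theorem isOddUnder_pairExtend (hg : IsPairFunction j τ g) (hi : τ i = i) (hk : τ k = k) :
    IsOddUnder τ (pairExtend g i k) := by
  intro l hl x
  have hfix : ∀ m, τ m = m → Equiv.swap l (τ l) m = m := fun m hm =>
    Equiv.swap_apply_of_ne_of_ne (by rintro rfl; exact hl hm)
      (by rintro rfl; exact hl (τ.injective hm))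
  simp only [pairExtend, hg.odd l hl, Function.comp_apply, hfix i hi, hfix k hk, neg_mul]

theorem extend (hg : IsPairFunction j τ g) (hik : i ≠ k) (hi : τ i = i) (hk : τ k = k) :
    IsPairFunction (j + 1) (Equiv.swap i k * τ) (pairExtend g i k) := by
  have hdisj : (Equiv.swap i k).Disjoint τ := by
    intro l
    by_contra! h
    obtain ⟨-, rfl | rfl⟩ := Equiv.swap_apply_ne_self_iff.1 h.1
    exacts [h.2 hi, h.2 hk]
  refine ⟨?_, fun l => ?_, (hg.isOddUnder_swap_pairExtend hi hk).mul hdisj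
    (hg.isOddUnder_pairExtend hi hk), fun l m hl hm x => ?_, fun x hx => ?_, fun x => ?_⟩
  · rw [hdisj.card_support_mul, Equiv.Perm.card_support_swap hik, hg.card_support]
    ring
  · rw [← Equiv.Perm.mul_apply, mul_assoc, ← mul_assoc τ, ← hdisj.commute.eq, mul_assoc,
      ← mul_assoc, Equiv.swap_mul_self, one_mul, Equiv.Perm.mul_apply, hg.involutive l]
  · rw [hdisj.mul_apply_eq_iff] at hl hm
    have hi' : ∀ m, Equiv.swap i k m = m → m ≠ i ∧ m ≠ k := by
      rintro m hm
      exact ⟨by rintro rfl; exact hik (by simpa using hm.symm),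
        by rintro rfl; exact hik (by simpa using hm)⟩
    simp only [pairExtend, hg.even l m hl.2 hm.2, Function.comp_apply,
      Equiv.swap_apply_of_ne_of_ne (hi' l hl.1).1.symm (hi' m hm.1).1.symm,
      Equiv.swap_apply_of_ne_of_ne (hi' l hl.1).2.symm (hi' m hm.1).2.symm]
  · rw [pairExtend, hg.eq_zero_of_weight_ne x hx, zero_mul]
  · rw [pairExtend, abs_mul]
    exact mul_le_one₀ (hg.abs_le_one x) (abs_nonneg _) (abs_bit_sub_bit_le_one _ _)

theorem abs_compKernel_mulVec_le (hN : 0 < N) {K : ℕ → Matrix (Cube N) (Cube N) ℝ}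
    (hK : ∀ i, 1 ≤ i → K i ∈ lazyFamily N 1) (hg : IsPairFunction j τ g) (n : ℕ) (x : Cube N) :
    |(compKernel K n *ᵥ g) x| ≤ damping N n ^ j := by
  have hj : j ≤ 2 * N := by
    have := (card_le_univ τ.support).trans_eq (Fintype.card_fin _)
    have := hg.card_support
    lia
  calc |(compKernel K n *ᵥ g) x| ≤ (1 - j / (2 * N)) ^ n * 1 :=
        hg.odd.abs_compKernel_mulVec_le hN hK hg.involutive hg.card_support hg.abs_le_one n x
    _ ≤ damping N n ^ j := by
        rw [mul_one]
        exact one_sub_div_pow_le_damping_pow hj n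

end IsPairFunction

/-! ### Expansion of point masses on the middle level into pair functions -/

/-- The probability that `r` given coordinates of a uniform vertex of the middle level of the
`2m`-dimensional cube are all equal to `1`. -/
noncomputable def midProb (m r : ℕ) : ℝ := m.descFactorial r / (2 * m).descFactorial r

theorem midProb_nonneg (m r : ℕ) : 0 ≤ midProb m r := by
  unfold midProb
  positivity

theorem midProb_zero (m : ℕ) : midProb m 0 = 1 := by simp [midProb]

theorem midProb_self (m : ℕ) : midProb m m = ((2 * m).choose m : ℝ)⁻¹ := by
  have : (m.factorial : ℝ) ≠ 0 := by exact_mod_cast m.factorial_ne_zero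
  rw [midProb, Nat.descFactorial_self, Nat.descFactorial_eq_factorial_mul_choose, Nat.cast_mul,
    div_mul_cancel_left₀ this]

theorem sub_mul_midProb_succ {m r : ℕ} (h : r < m) :
    (2 * m - r) * midProb m (r + 1) = (m - r) * midProb m r := by
  have h2 : ((2 * m).descFactorial r : ℝ) ≠ 0 := by
    exact_mod_cast (Nat.descFactorial_pos.2 (by lia)).ne'
  have h3 : (2 * m - r : ℝ) ≠ 0 := by
    have : (r : ℝ) < m := by exact_mod_cast h
    linarith [m.cast_nonneg (α := ℝ)]
  rw [midProb, midProb, Nat.descFactorial_succ, Nat.descFactorial_succ]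
  push_cast [Nat.cast_sub h.le, Nat.cast_sub (show r ≤ 2 * m by lia)]
  field_simp

theorem sub_mul_midProb (m r : ℕ) (h : r ≤ m) :
    (2 * m + 1 - r) * midProb m r = 2 * (2 * m + 1) * midProb (m + 1) (r + 1) := by
  have h0 : ((2 * m).descFactorial r : ℝ) ≠ 0 := by
    exact_mod_cast (Nat.descFactorial_pos.2 (by lia)).ne'
  have h1 : ((2 * m + 1).descFactorial r : ℝ) ≠ 0 := by
    exact_mod_cast (Nat.descFactorial_pos.2 (by lia)).ne'
  have hshift : (2 * m + 1 - r : ℝ) * (2 * m + 1).descFactorial r =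
      (2 * m + 1) * (2 * m).descFactorial r := by
    have := (Nat.descFactorial_succ (2 * m + 1) r).symm.trans
      (Nat.succ_descFactorial_succ (2 * m) r)
    have := congrArg (Nat.cast (R := ℝ)) this
    push_cast [Nat.cast_sub (show r ≤ 2 * m + 1 by lia)] at this
    exact this
  have hprob : midProb (m + 1) (r + 1) =
      m.descFactorial r / (2 * (2 * m + 1).descFactorial r) := by
    rw [midProb, mul_add_one 2 m, Nat.succ_descFactorial_succ,
      Nat.succ_descFactorial_succ (2 * m + 1),
      ← mul_div_mul_left (m.descFactorial r : ℝ) _ (m.cast_add_one_ne_zero (R := ℝ))]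
    push_cast
    congr 1
    ring
  rw [hprob, midProb, ← mul_div_assoc, ← mul_div_assoc,
    div_eq_div_iff h0 (mul_ne_zero two_ne_zero h1)]
  linear_combination (2 * m.descFactorial r : ℝ) * hshift

theorem sub_mul_midProb_le {m r : ℕ} (h : r ≤ m) :
    (2 * m + 1 - r) * midProb m r ≤ 4 * (2 * m + 2 - r) * midProb (m + 1) (r + 1) := by
  have hrm : (r : ℝ) ≤ m := by exact_mod_cast h
  rw [sub_mul_midProb m r h]
  exact mul_le_mul_of_nonneg_right (by linarith) (midProb_nonneg _ _)

/-- The indicator function of the event that all coordinates in `T` are equal to `1`. -/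
noncomputable def allOnes (T : Finset (Fin (2 * N))) (x : Cube N) : ℝ := ∏ l ∈ T, bit (x l)

theorem allOnes_mul_sum_bit (T : Finset (Fin (2 * N))) (x : Cube N) :
    allOnes T x * ∑ l ∈ T, bit (x l) = #T * allOnes T x := by
  have h : ∀ l ∈ T, allOnes T x * bit (x l) = allOnes T x := by
    intro l hl
    rcases bit_eq_zero_or_one (x l) with h | h
    · rw [allOnes, prod_eq_zero hl h, zero_mul]
    · rw [h, mul_one]
  rw [mul_sum, sum_congr rfl h, sum_const, nsmul_eq_mul]

theorem midIndicator_mul_allOnes {z : Cube N} (hz : weight z = N) :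
    midIndicator N * allOnes {l | z l = 1} = Pi.single z 1 := by
  ext y
  rw [Pi.mul_apply, Pi.single_apply]
  split_ifs with hy
  · subst hy
    rw [midIndicator, if_pos hz, one_mul]
    refine prod_eq_one fun l hl => ?_
    rw [(mem_filter.1 hl).2, bit_one]
  · by_contra h
    obtain ⟨hmid, hones⟩ := mul_ne_zero_iff.1 h
    have hyN : weight y = N := of_not_not fun hyN => hmid (if_neg hyN)
    have hfin : ∀ a : Fin 2, a ≠ 1 → a = 0 := by decide
    have hsub : ({l | z l = 1} : Finset _) ⊆ ({l | y l = 1} : Finset _) := by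
      intro l hl
      have hbit := prod_ne_zero_iff.1 hones l hl
      exact (mem_filter_univ _).2 (of_not_not fun hyl => hbit (by rw [hfin _ hyl, bit_zero]))
    have heq := eq_of_subset_of_card_le hsub (by rw [← weight_eq_card, ← weight_eq_card, hyN, hz])
    refine hy (funext fun l => ?_)
    have hl : z l = 1 ↔ y l = 1 := by simpa using Finset.ext_iff.1 heq l
    by_cases h1 : z l = 1
    · rw [hl.1 h1, h1]
    · rw [hfin _ h1, hfin _ (mt hl.2 h1)]

theorem disjoint_support_swap_mul {α : Type*} [DecidableEq α] [Fintype α] {i k : α}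
    {T : Finset α} {τ : Equiv.Perm α} (hi : i ∉ T) (hk : k ∉ T) (hT : Disjoint T τ.support) :
    Disjoint T (Equiv.swap i k * τ).support := by
  refine (disjoint_union_right.2 ⟨disjoint_left.2 fun l hl => ?_, hT⟩).mono_right
    (Equiv.Perm.support_mul_le _ _)
  rw [Equiv.Perm.notMem_support]
  exact Equiv.swap_apply_of_ne_of_ne (ne_of_mem_of_not_mem hl hi) (ne_of_mem_of_not_mem hl hk)

section LinearFunctional

variable {j m : ℕ} {τ : Equiv.Perm (Fin (2 * N))} {g : Cube N → ℝ} {T : Finset (Fin (2 * N))}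
  {i : Fin (2 * N)}

theorem IsPairFunction.sum_support_bit (hg : IsPairFunction j τ g) {x : Cube N} (hx : g x ≠ 0) :
    ∑ l ∈ τ.support, bit (x l) = j := by
  rw [sum_support_of_involutive hg.involutive (c := 1 / 2), hg.card_support]
  · push_cast
    ring
  · intro l hl
    rw [bit_add_bit_of_ne fun h => hx (hg.odd.eq_zero hl h)]
    norm_num

theorem IsPairFunction.card_compl (hg : IsPairFunction j τ g) (hjm : j + m = N) (hi : i ∉ T)
    (hT : Disjoint (insert i T) τ.support) :
    (#(insert i T ∪ τ.support)ᶜ : ℝ) = 2 * m - #T - 1 := by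
  have h := card_add_card_compl (insert i T ∪ τ.support)
  rw [card_union_of_disjoint hT, card_insert_of_notMem hi, hg.card_support, Fintype.card_fin] at h
  have h' := congrArg (Nat.cast (R := ℝ)) h
  have hjm' : (j : ℝ) + m = N := by exact_mod_cast hjm
  push_cast at h'
  linarith

theorem IsPairFunction.mul_allOnes_insert (hg : IsPairFunction j τ g) (hjm : j + m = N)
    (hi : i ∉ T) (hT : Disjoint (insert i T) τ.support) :
    (2 * m - #T : ℝ) • (g * allOnes (insert i T)) = (m - #T : ℝ) • (g * allOnes T) +
      ∑ k ∈ (insert i T ∪ τ.support)ᶜ, pairExtend g i k * allOnes T := by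
  ext x
  simp only [Pi.smul_apply, Pi.mul_apply, smul_eq_mul, Pi.add_apply, Finset.sum_apply, pairExtend,
    ← sum_mul, ← mul_sum, sum_sub_distrib, sum_const, nsmul_eq_mul]
  by_cases hx : g x = 0
  · simp only [hx, zero_mul, mul_zero, add_zero]
  have hweight := weight_eq_sum_bit x
  rw [of_not_not fun h => hx (hg.eq_zero_of_weight_ne x h),
    ← sum_add_sum_compl (insert i T ∪ τ.support), sum_union hT, sum_insert hi,
    hg.sum_support_bit hx] at hweight
  have hjm' : (j : ℝ) + m = N := by exact_mod_cast hjm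
  rw [hg.card_compl hjm hi hT, show allOnes (insert i T) x = bit (x i) * allOnes T x from
    prod_insert hi]
  linear_combination (-g x) * allOnes_mul_sum_bit T x - (g x * allOnes T x) * (hweight + hjm')

theorem abs_sub_mul_le_of_recursion {a a' e p p' s t u θ c d : ℝ} (hc : 0 < c) (hd : 0 ≤ d)
    (ha : c * a' = d * a + s) (hp : c * p' = d * p) (h : |a - p * e| ≤ p * t * (u - 1))
    (hs : |s| ≤ 4 * c * p' * (t * θ * u)) : |a' - p' * e| ≤ p' * t * (u * (1 + 4 * θ) - 1) := by
  refine le_of_mul_le_mul_left ?_ hc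
  calc c * |a' - p' * e| = |d * (a - p * e) + s| := by
        rw [show d * (a - p * e) + s = c * (a' - p' * e) by linear_combination e * hp - ha,
          abs_mul, abs_of_pos hc]
    _ ≤ d * |a - p * e| + |s| := (abs_add_le _ _).trans_eq (by rw [abs_mul, abs_of_nonneg hd])
    _ ≤ d * (p * t * (u - 1)) + 4 * c * p' * (t * θ * u) := by gcongr
    _ = c * (p' * t * (u * (1 + 4 * θ) - 1)) := by linear_combination (-t * (u - 1)) * hp

theorem abs_le_of_abs_sub_mul_le {a e p t u : ℝ} (hp : 0 ≤ p)
    (h : |a - p * e| ≤ p * t * (u - 1)) (he : |e| ≤ t) : |a| ≤ p * (t * u) := by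
  calc |a| ≤ |a - p * e| + |p * e| := by simpa using abs_add_le (a - p * e) (p * e)
    _ ≤ p * t * (u - 1) + p * t := by
        rw [abs_mul, abs_of_nonneg hp]
        gcongr
    _ = p * (t * u) := by ring

variable {E : (Cube N → ℝ) →ₗ[ℝ] ℝ} {θ : ℝ}

theorem abs_map_mul_allOnes_sub_le (hθ : 0 ≤ θ)
    (hE : ∀ {j τ g}, IsPairFunction j τ g → |E g| ≤ θ ^ j) (hg : IsPairFunction j τ g)
    (hjm : j + m = N) (hT : Disjoint T τ.support) (hTm : #T ≤ m) :
    |E (g * allOnes T) - midProb m #T * E g| ≤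
      midProb m #T * θ ^ j * ((1 + 4 * θ) ^ #T - 1) := by
  induction T using Finset.induction_on generalizing j m τ g with
  | empty =>
    have : allOnes (∅ : Finset (Fin (2 * N))) = 1 := rfl
    simp [this, midProb_zero]
  | insert i T hi ih =>
    rw [card_insert_of_notMem hi] at hTm ⊢
    obtain ⟨m, rfl⟩ : ∃ m', m = m' + 1 := ⟨m - 1, by lia⟩
    have hTτ : Disjoint T τ.support := hT.mono_left (subset_insert i T)
    have hrm : (#T : ℝ) ≤ m := by exact_mod_cast Nat.le_of_succ_le_succ hTm
    set R := (insert i T ∪ τ.support)ᶜ with hR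
    have hterm : ∀ k ∈ R, |E (pairExtend g i k * allOnes T)| ≤
        midProb m #T * (θ ^ j * θ * (1 + 4 * θ) ^ #T) := by
      intro k hk
      simp only [hR, mem_compl, mem_union, mem_insert, Equiv.Perm.mem_support, not_or,
        not_not] at hk
      obtain ⟨⟨hki, hkT⟩, hk⟩ := hk
      have hiτ : τ i = i := by simpa using disjoint_left.1 hT (mem_insert_self i T)
      have hext := hg.extend (Ne.symm hki) hiτ hk
      have hsub := ih hext (by lia) (disjoint_support_swap_mul hi hkT hTτ)
        (Nat.le_of_succ_le_succ hTm)
      rw [← pow_succ]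
      exact abs_le_of_abs_sub_mul_le (midProb_nonneg m #T) hsub (hE hext)
    have hs : |∑ k ∈ R, E (pairExtend g i k * allOnes T)| ≤
        4 * (2 * (m + 1 : ℕ) - #T) * midProb (m + 1) (#T + 1) *
          (θ ^ j * θ * (1 + 4 * θ) ^ #T) := by
      refine (abs_sum_le_sum_abs _ _).trans ((sum_le_card_nsmul _ _ _ hterm).trans ?_)
      rw [nsmul_eq_mul, hg.card_compl hjm hi hT, ← mul_assoc]
      have := mul_le_mul_of_nonneg_right (sub_mul_midProb_le (Nat.le_of_succ_le_succ hTm))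
        (by positivity : 0 ≤ θ ^ j * θ * (1 + 4 * θ) ^ #T)
      push_cast
      convert this using 3 <;> ring
    have hrec := congrArg E (hg.mul_allOnes_insert hjm hi hT)
    simp only [map_add, map_smul, map_sum, smul_eq_mul] at hrec
    rw [pow_succ (1 + 4 * θ)]
    refine abs_sub_mul_le_of_recursion ?_ ?_ hrec (sub_mul_midProb_succ hTm)
      (ih hg hjm hTτ (by lia)) hs <;> push_cast <;> linarith

theorem abs_map_single_sub_le (hθ : 0 ≤ θ)
    (hE : ∀ {j τ g}, IsPairFunction j τ g → |E g| ≤ θ ^ j) {z : Cube N} (hz : weight z = N) :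
    |E (Pi.single z 1) - ((2 * N).choose N : ℝ)⁻¹ * E (midIndicator N)| ≤
      ((2 * N).choose N : ℝ)⁻¹ * ((1 + 4 * θ) ^ N - 1) := by
  have hcard : #{l | z l = 1} = N := (weight_eq_card z).symm.trans hz
  have h := abs_map_mul_allOnes_sub_le hθ hE isPairFunction_midIndicator (zero_add N)
    (T := {l | z l = 1}) (by simp) hcard.le
  rwa [midIndicator_mul_allOnes hz, hcard, midProb_self, pow_zero, mul_one] at h

end LinearFunctional

variable {K : ℕ → Matrix (Cube N) (Cube N) ℝ}

/-- The density of `K_{0,n}(x, ·)` with respect to the uniform probability on the cube. -/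
noncomputable def density (K : ℕ → Matrix (Cube N) (Cube N) ℝ) (n : ℕ) (x z : Cube N) : ℝ :=
  4 ^ N * compKernel K n x z

theorem four_pow_mul_inv_choose_le (hN : 0 < N) : 4 ^ N * ((2 * N).choose N : ℝ)⁻¹ ≤ 2 * N := by
  rw [← div_eq_mul_inv, div_le_iff₀ (Nat.cast_pos.2 (Nat.choose_pos (by lia))),
    ← Nat.centralBinom_eq_two_mul_choose]
  exact_mod_cast Nat.four_pow_le_two_mul_self_mul_centralBinom N hN

theorem abs_density_sub_one_le (hN : 0 < N) (hK : ∀ i, 1 ≤ i → K i ∈ lazyFamily N 1) (n : ℕ)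
    (x : Cube N) {z : Cube N} (hz : weight z = N) :
    |density K n x z - 1| ≤
      2 * N * ((1 + 4 * damping N n) ^ N - 1) + ((1 + damping N n) ^ (2 * N) - 1) := by
  set C : ℝ := ((2 * N).choose N : ℝ)
  set M := (compKernel K n *ᵥ midIndicator N) x
  have hC : 0 < C := Nat.cast_pos.2 (Nat.choose_pos (by lia))
  have h4C : 4 ^ N * C⁻¹ ≤ 2 * N := four_pow_mul_inv_choose_le hN
  have hpoint : |compKernel K n x z - C⁻¹ * M| ≤ C⁻¹ * ((1 + 4 * damping N n) ^ N - 1) := by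
    simpa using abs_map_single_sub_le
      (E := (LinearMap.proj x).comp (compKernel K n).mulVecLin) (damping_pos N n).le
      (fun hg => hg.abs_compKernel_mulVec_le hN hK n x) hz
  have hmass : |4 ^ N * M - C| ≤ C * ((1 + damping N n) ^ (2 * N) - 1) :=
    abs_four_pow_mul_compKernel_mulVec_midIndicator_sub_le hN
      (fun i hi => Set.image_subset_range _ _ (hK i hi)) n x
  have hE : 0 ≤ (1 + 4 * damping N n) ^ N - 1 :=
    sub_nonneg.2 (one_le_pow₀ (by linarith [damping_pos N n]))
  calc |density K n x z - 1|
      = |4 ^ N * (compKernel K n x z - C⁻¹ * M) + C⁻¹ * (4 ^ N * M - C)| := by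
        rw [density]
        congr 1
        field_simp
        ring
    _ ≤ 4 ^ N * |compKernel K n x z - C⁻¹ * M| + C⁻¹ * |4 ^ N * M - C| := by
        refine (abs_add_le _ _).trans_eq ?_
        rw [abs_mul, abs_mul, abs_of_pos (by positivity : (0 : ℝ) < 4 ^ N),
          abs_of_pos (inv_pos.2 hC)]
    _ ≤ 4 ^ N * (C⁻¹ * ((1 + 4 * damping N n) ^ N - 1)) +
          C⁻¹ * (C * ((1 + damping N n) ^ (2 * N) - 1)) := by gcongr
    _ = 4 ^ N * C⁻¹ * ((1 + 4 * damping N n) ^ N - 1) + ((1 + damping N n) ^ (2 * N) - 1) := by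
        rw [mul_assoc, inv_mul_cancel_left₀ hC.ne']
    _ ≤ 2 * N * ((1 + 4 * damping N n) ^ N - 1) + ((1 + damping N n) ^ (2 * N) - 1) := by
        gcongr

/-! ### Comparison with the simple random walk off the middle level -/

theorem lazyFamily_mono : Monotone (lazyFamily N) := fun _ _ h =>
  Set.image_mono (Set.Icc_subset_Icc (neg_le_neg h) h)

theorem density_succ (K : ℕ → Matrix (Cube N) (Cube N) ℝ) (n : ℕ) (x : Cube N) :
    density K (n + 1) x = density K n x ᵥ* K (n + 1) :=
  (smul_vecMul ((4 : ℝ) ^ N) (compKernel K n x) _).symm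

theorem density_nonneg (hN : 0 < N) (hK : ∀ i, 1 ≤ i → K i ∈ lazyFamily N 1) (n : ℕ)
    (x z : Cube N) : 0 ≤ density K n x z :=
  mul_nonneg (by positivity) <| nonneg_of_mem_rowStochastic <| compKernel_mem_rowStochastic
    (fun i hi => mem_rowStochastic_of_mem_lazyFamily hN le_rfl (hK i hi)) n

section Comparison

variable {ε : ℝ} {m : ℕ} {G H : ℕ → Cube N → ℝ}

theorem vecMul_apply_le_of_mem_lazyFamily (hε : 0 ≤ ε) {Q : Matrix (Cube N) (Cube N) ℝ}
    (hQ : Q ∈ lazyFamily N ε) {g h : Cube N → ℝ} (hle : ∀ y, weight y ≠ N → g y ≤ h y)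
    (hmid : ∀ y, weight y = N → ∀ c ∈ Set.Icc (1 - ε) (1 + ε), c * g y ≤ h y)
    {z : Cube N} (hz : weight z ≠ N) : (g ᵥ* Q) z ≤ (lazyDriftKernel N 0 *ᵥ h) z := by
  obtain ⟨δ, hδ, rfl⟩ := hQ
  rw [vecMul_lazyDriftKernel, lazyDriftKernel_zero_mulVec]
  gcongr with i
  · exact hle z hz
  · by_cases hi : weight (flipAt i z) = N
    · exact hmid _ hi _ (flipRate_mem_Icc hε hδ _ _)
    · rw [flipRate_of_weight_ne hi, one_mul]
      exact hle _ hi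

/-- Off the middle level every kernel of the family moves like the simple random walk, so the
values on the middle level, distorted by at most a factor `c`, play the role of boundary data. -/
theorem le_of_supersolution (hε : 0 ≤ ε) (hK : ∀ i, 1 ≤ i → K i ∈ lazyFamily N ε)
    (hG : ∀ k, G (k + 1) = G k ᵥ* K (m + k + 1))
    (hH : ∀ k z, weight z ≠ N → (lazyDriftKernel N 0 *ᵥ H k) z ≤ H (k + 1) z)
    (h0 : ∀ z, weight z ≠ N → G 0 z ≤ H 0 z)
    (hmid : ∀ k z, weight z = N → ∀ c ∈ Set.Icc (1 - ε) (1 + ε), c * G k z ≤ H k z) (k : ℕ) :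
    ∀ z, weight z ≠ N → G k z ≤ H k z := by
  induction k with
  | zero => exact h0
  | succ k ih =>
    intro z hz
    rw [hG]
    exact (vecMul_apply_le_of_mem_lazyFamily hε (hK _ (by lia)) ih (hmid k) hz).trans (hH k z hz)

theorem lazyDriftKernel_zero_mulVec_midDist (hN : 0 < N) {z : Cube N} (hz : weight z ≠ N) :
    (lazyDriftKernel N 0 *ᵥ midDist) z = (1 - 1 / (2 * N)) * midDist z := by
  have hN' : (N : ℝ) ≠ 0 := by positivity
  rw [lazyDriftKernel_zero_mulVec, sum_comp_midDist_flipAt fun d => d,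
    abs_of_nonneg (sub_nonneg.2 (one_le_midDist hz))]
  field_simp
  ring

theorem le_pow_mul_midDist_add (hN : 0 < N) (hε : 0 ≤ ε)
    (hK : ∀ i, 1 ≤ i → K i ∈ lazyFamily N ε) (hG : ∀ k, G (k + 1) = G k ᵥ* K (m + k + 1))
    {a b : ℝ} (h0 : ∀ z, weight z ≠ N → G 0 z ≤ a * midDist z + b)
    (hmid : ∀ k z, weight z = N → ∀ c ∈ Set.Icc (1 - ε) (1 + ε), c * G k z ≤ b)
    (k : ℕ) {z : Cube N} (hz : weight z ≠ N) :
    G k z ≤ a * ((1 - 1 / (2 * N)) ^ k * midDist z) + b := by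
  refine le_of_supersolution hε hK hG
    (H := fun k => a • ((1 - 1 / (2 * N) : ℝ) ^ k • midDist) + b • 1) (fun k z hz => ?_)
    (fun z hz => ?_) (fun k z hz c hc => ?_) k z hz |>.trans_eq (by simp)
  · rw [mulVec_add, mulVec_smul, mulVec_smul, mulVec_smul,
      one_vecMul_of_mem_rowStochastic (lazyDriftKernel_mem_rowStochastic hN (by simp))]
    simp only [Pi.add_apply, Pi.smul_apply, lazyDriftKernel_zero_mulVec_midDist hN hz, smul_eq_mul,
      pow_succ, mul_assoc, le_refl]
  · simpa using h0 z hz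
  · simpa [midDist_eq_zero.2 hz] using hmid k z hz c hc

end Comparison

section Density

variable {m : ℕ}

theorem density_le_six (hN : 0 < N) (hK : ∀ i, 1 ≤ i → K i ∈ lazyFamily N 1)
    (hfree : ∀ k, m ≤ k → ∀ y z, 4 ^ N * (lazyDriftKernel N 0 ^ k) y z ≤ 2)
    (hmid : ∀ k, m ≤ k → ∀ y z, weight z = N → density K k y z ≤ 2) {n : ℕ} (hn : 2 * m ≤ n)
    (x : Cube N) {z : Cube N} (hz : weight z ≠ N) : density K n x z ≤ 6 := by
  have hKrow := compKernel_mem_rowStochastic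
    (fun i hi => mem_rowStochastic_of_mem_lazyFamily hN le_rfl (hK i hi)) m
  set Q := lazyDriftKernel N 0
  have hQrow : Q ∈ rowStochastic ℝ (Cube N) := lazyDriftKernel_mem_rowStochastic hN (by simp)
  set A : ℕ → Cube N → ℝ := fun k => density K m x ᵥ* Q ^ k
  have hA : ∀ k z, A k z = (compKernel K m * (4 : ℝ) ^ N • Q ^ k) x z := by
    intro k z
    rw [Matrix.mul_smul, ← Matrix.smul_mul]
    rfl
  have hA_nonneg : ∀ k z, 0 ≤ A k z := fun k =>
    nonneg_vecMul_of_mem_rowStochastic (pow_mem hQrow k) (density_nonneg hN hK m x)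
  have hcomp := le_of_supersolution zero_le_one hK (m := m) (G := fun k => density K (m + k) x)
    (H := fun k => A k + (4 : ℝ) • 1) (fun k => density_succ K (m + k) x) ?_ ?_ ?_ (n - m) z hz
  · have hle : A (n - m) z ≤ 2 := by
      rw [hA]
      exact mul_apply_le_of_mem_rowStochastic hKrow (fun y => hfree _ (by lia) y z) x
    rw [Nat.add_sub_cancel' (by lia)] at hcomp
    simp only [Pi.add_apply, Pi.smul_apply, Pi.one_apply, smul_eq_mul] at hcomp
    linarith
  · intro k z _
    rw [mulVec_add, mulVec_smul, one_vecMul_of_mem_rowStochastic hQrow,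
      ← vecMul_lazyDriftKernel_zero, vecMul_vecMul, ← pow_succ]
  · intro z _
    simp [A]
  · intro k y hy c hc
    have h2 : c * density K (m + k) x y ≤ 2 * 2 :=
      mul_le_mul (by linarith [hc.2]) (hmid _ (by lia) x y hy) (density_nonneg hN hK _ _ _)
        zero_le_two
    simp only [Pi.add_apply, Pi.smul_apply, Pi.one_apply, smul_eq_mul]
    linarith [hA_nonneg k y]

theorem density_sub_density_le (hN : 0 < N) (hK : ∀ i, 1 ≤ i → K i ∈ lazyFamily N 1) {e : ℝ}
    (he : 0 ≤ e) (hmid : ∀ k, m ≤ k → ∀ y z, weight z = N → |density K k y z - 1| ≤ e)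
    (hup : ∀ y z, weight z ≠ N → density K m y z ≤ 6) (k : ℕ) (x y : Cube N) {z : Cube N}
    (hz : weight z ≠ N) :
    density K (m + k) x z - density K (m + k) y z ≤
      6 * ((1 - 1 / (2 * N)) ^ k * midDist z) + 4 * e := by
  refine le_pow_mul_midDist_add hN zero_le_one hK (m := m)
    (G := fun k => density K (m + k) x - density K (m + k) y) (fun k => ?_) (fun z hz => ?_)
    (fun k z hz c hc => ?_) k hz
  · rw [sub_vecMul, ← density_succ, ← density_succ]
    rfl
  · have := density_nonneg hN hK m y z
    simp only [add_zero, Pi.sub_apply]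
    linarith [hup x z hz, one_le_midDist hz]
  · have hx := (abs_le.1 (hmid (m + k) (by lia) x z hz)).2
    have hy := (abs_le.1 (hmid (m + k) (by lia) y z hz)).1
    calc c * (density K (m + k) x z - density K (m + k) y z) ≤ c * (2 * e) :=
          mul_le_mul_of_nonneg_left (by linarith) (by linarith [hc.1])
      _ ≤ 2 * (2 * e) := mul_le_mul_of_nonneg_right (by linarith [hc.2]) (by linarith)
      _ = 4 * e := by ring

theorem le_density {ε : ℝ} (hN : 0 < N) (hε : ε ∈ Set.Icc 0 1)
    (hK : ∀ i, 1 ≤ i → K i ∈ lazyFamily N ε)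
    (hmid : ∀ k, m ≤ k → ∀ y z, weight z = N → 1 / 2 ≤ density K k y z) (k : ℕ) (x : Cube N)
    {z : Cube N} (hz : weight z ≠ N) :
    (1 - ε) / 2 * (1 - (1 - 1 / (2 * N)) ^ k * midDist z) ≤ density K (m + k) x z := by
  have h := le_pow_mul_midDist_add hN hε.1 hK (m := m) (G := fun k => -density K (m + k) x)
    (a := (1 - ε) / 2) (b := -((1 - ε) / 2)) (fun k => ?_) (fun z hz => ?_)
    (fun k z hz c hc => ?_) k hz
  · rw [Pi.neg_apply] at h
    linarith
  · rw [neg_vecMul, ← density_succ]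
    rfl
  · have hpos := density_nonneg hN (fun i hi => lazyFamily_mono hε.2 (hK i hi)) m x z
    have hdist := mul_le_mul_of_nonneg_left (one_le_midDist hz)
      (by linarith [hε.2] : 0 ≤ (1 - ε) / 2)
    simp only [add_zero, Pi.neg_apply]
    linarith
  · have h := mul_le_mul hc.1 (hmid (m + k) (by lia) x z hz) (by norm_num)
      (by linarith [hc.1, hε.2])
    rw [Pi.neg_apply]
    linarith

end Density

/-! ### Merging of densities -/

theorem damping_antitone : Antitone (damping N) := by
  intro m n hmn
  unfold damping
  gcongr

theorem one_add_pow_sub_one_le {t : ℝ} (ht : 0 ≤ t) {k : ℕ} (h : k * t ≤ 1) :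
    (1 + t) ^ k - 1 ≤ 2 * (k * t) := by
  have h0 : 0 ≤ k * t := by positivity
  have hpow : (1 + t) ^ k ≤ Real.exp (k * t) := by
    rw [Real.exp_nat_mul, add_comm]
    gcongr
    exact Real.add_one_le_exp t
  have hexp := Real.abs_exp_sub_one_le (x := k * t) (by rwa [abs_of_nonneg h0])
  rw [abs_of_nonneg h0] at hexp
  linarith [le_abs_self (Real.exp (k * t) - 1)]

/-- The quantity `N² e^{-n/2N}`, which controls up to constants all deviations from
equilibrium at time `n`. -/
noncomputable def mixError (N n : ℕ) : ℝ := N ^ 2 * damping N n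

theorem mixError_nonneg (N n : ℕ) : 0 ≤ mixError N n :=
  mul_nonneg (by positivity) (damping_pos N n).le

theorem mixError_antitone : Antitone (mixError N) := fun _ _ h =>
  mul_le_mul_of_nonneg_left (damping_antitone h) (by positivity)

theorem mul_damping_le_mixError (hN : 0 < N) (n : ℕ) : N * damping N n ≤ mixError N n :=
  mul_le_mul_of_nonneg_right (le_self_pow₀ (by exact_mod_cast hN) two_ne_zero) (damping_pos N n).le

theorem one_add_damping_pow_sub_one_le (hN : 0 < N) {n : ℕ} (h : mixError N n ≤ 1 / 40) :
    (1 + damping N n) ^ (2 * N) - 1 ≤ 4 * mixError N n := by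
  have hle := mul_damping_le_mixError hN n
  have hpow := one_add_pow_sub_one_le (damping_pos N n).le (k := 2 * N) (by push_cast; linarith)
  push_cast at hpow
  linarith

theorem four_pow_mul_pow_lazyDriftKernel_zero_le_two (hN : 0 < N) {n : ℕ}
    (h : mixError N n ≤ 1 / 40) (x z : Cube N) : 4 ^ N * (lazyDriftKernel N 0 ^ n) x z ≤ 2 := by
  have habs := abs_four_pow_mul_pow_lazyDriftKernel_zero_sub_one_le hN n x z
  linarith [(abs_le.1 habs).2, one_add_damping_pow_sub_one_le hN h]

theorem abs_density_sub_one_le_mixError (hN : 0 < N) (hK : ∀ i, 1 ≤ i → K i ∈ lazyFamily N 1)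
    {n : ℕ} (h : mixError N n ≤ 1 / 40) (x : Cube N) {z : Cube N} (hz : weight z = N) :
    |density K n x z - 1| ≤ 20 * mixError N n := by
  have hle := mul_damping_le_mixError hN n
  have hslice : 2 * N * ((1 + 4 * damping N n) ^ N - 1) ≤ 16 * mixError N n := by
    calc 2 * N * ((1 + 4 * damping N n) ^ N - 1)
        ≤ 2 * N * (2 * (N * (4 * damping N n))) := by
          gcongr
          exact one_add_pow_sub_one_le (by linarith [damping_pos N n]) (by linarith)
      _ = 16 * mixError N n := by
          rw [mixError]
          ring
  linarith [abs_density_sub_one_le hN hK n x hz, one_add_damping_pow_sub_one_le hN h]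

theorem pow_mul_midDist_le_mixError (hN : 0 < N) (n : ℕ) (z : Cube N) :
    (1 - 1 / (2 * N)) ^ n * midDist z ≤ mixError N n := by
  have hpow : (1 - 1 / (2 * N) : ℝ) ^ n ≤ damping N n := by
    simpa using one_sub_div_pow_le_damping_pow (N := N) (j := 1) (by lia) n
  calc (1 - 1 / (2 * N)) ^ n * midDist z ≤ damping N n * N :=
        mul_le_mul hpow (midDist_le z) (midDist_nonneg z) (damping_pos N n).le
    _ ≤ mixError N n := (mul_comm _ _).trans_le (mul_damping_le_mixError hN n)

section Merging

variable {m n : ℕ}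

theorem abs_density_sub_density_le (hN : 0 < N) (hK : ∀ i, 1 ≤ i → K i ∈ lazyFamily N 1)
    (hm : mixError N m ≤ 1 / 40) (hn : 3 * m ≤ n) (x y z : Cube N) :
    |density K n x z - density K n y z| ≤ 86 * mixError N m := by
  have hs := mixError_nonneg N m
  have hsmall : ∀ k, m ≤ k → mixError N k ≤ 1 / 40 := fun k hk => (mixError_antitone hk).trans hm
  have hmid : ∀ k, m ≤ k → ∀ y z, weight z = N → |density K k y z - 1| ≤ 20 * mixError N m :=
    fun k hk y z hz => (abs_density_sub_one_le_mixError hN hK (hsmall k hk) y hz).trans <|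
      mul_le_mul_of_nonneg_left (mixError_antitone hk) (by norm_num)
  by_cases hz : weight z = N
  · have hx := abs_le.1 (hmid n (by lia) x z hz)
    have hy := abs_le.1 (hmid n (by lia) y z hz)
    exact abs_le.2 ⟨by linarith [hx.1, hy.2], by linarith [hx.2, hy.1]⟩
  obtain ⟨k, rfl⟩ := Nat.exists_eq_add_of_le (show 2 * m ≤ n by lia)
  have hup : ∀ y z, weight z ≠ N → density K (2 * m) y z ≤ 6 := fun y z hz =>
    density_le_six hN hK
      (fun k hk => four_pow_mul_pow_lazyDriftKernel_zero_le_two hN (hsmall k hk))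
      (fun k hk y z hz => by linarith [(abs_le.1 (hmid k hk y z hz)).2]) le_rfl y hz
  have hsub : ∀ x y, density K (2 * m + k) x z - density K (2 * m + k) y z ≤ 86 * mixError N m := by
    intro x y
    have hle := density_sub_density_le hN hK (e := 20 * mixError N m) (by positivity)
      (fun k hk => hmid k (by lia)) hup k x y hz
    have hdist := (pow_mul_midDist_le_mixError hN k z).trans
      (mixError_antitone (show m ≤ k by lia))
    linarith
  exact abs_sub_le_iff.2 ⟨hsub x y, hsub y x⟩

variable {ε : ℝ}

theorem one_sub_div_four_le_density (hN : 0 < N) (hε : ε ∈ Set.Icc 0 1)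
    (hK : ∀ i, 1 ≤ i → K i ∈ lazyFamily N ε) (hm : mixError N m ≤ 1 / 40) (hn : 2 * m ≤ n)
    (x z : Cube N) : (1 - ε) / 4 ≤ density K n x z := by
  have hsmall : ∀ k, m ≤ k → mixError N k ≤ 1 / 40 := fun k hk => (mixError_antitone hk).trans hm
  have hmid : ∀ k, m ≤ k → ∀ y z, weight z = N → 1 / 2 ≤ density K k y z := fun k hk y z hz => by
    have habs := abs_density_sub_one_le_mixError hN
      (fun i hi => lazyFamily_mono hε.2 (hK i hi)) (hsmall k hk) y hz
    linarith [(abs_le.1 habs).1, hsmall k hk]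
  by_cases hz : weight z = N
  · linarith [hmid n (by lia) x z hz, hε.1]
  obtain ⟨k, rfl⟩ := Nat.exists_eq_add_of_le (show m ≤ n by lia)
  have hdist := (pow_mul_midDist_le_mixError hN k z).trans (hsmall k (by lia))
  calc (1 - ε) / 4 = (1 - ε) / 2 * (1 / 2) := by ring
    _ ≤ (1 - ε) / 2 * (1 - (1 - 1 / (2 * N)) ^ k * midDist z) :=
        mul_le_mul_of_nonneg_left (by linarith) (by linarith [hε.2])
    _ ≤ density K (m + k) x z := le_density hN hε hK hmid k x hz

theorem maxRelDev_le_mixError (hN : 0 < N) (hε : ε ∈ Set.Ico 0 1)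
    (hK : ∀ i, 1 ≤ i → K i ∈ lazyFamily N ε) (hm : mixError N m ≤ 1 / 40) (hn : 3 * m ≤ n) :
    maxRelDev K n ≤ ENNReal.ofReal (344 / (1 - ε) * mixError N m) := by
  have hε1 : 0 < 1 - ε := sub_pos.2 hε.2
  have h4 : (4 : ℝ) ^ N ≠ 0 := by positivity
  refine iSup_le fun x => iSup_le fun y => iSup_le fun z => ?_
  have hlow := one_sub_div_four_le_density hN ⟨hε.1, hε.2.le⟩ hK hm (by lia : 2 * m ≤ n) y z
  rw [← relDev_mul_left h4]
  refine relDev_le_of_abs_sub_le (lt_of_lt_of_le (by positivity) hlow) ?_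
  have hs := mixError_nonneg N m
  calc |density K n x z - density K n y z| ≤ 86 * mixError N m :=
        abs_density_sub_density_le hN (fun i hi => lazyFamily_mono hε.2.le (hK i hi)) hm hn x y z
    _ = 344 / (1 - ε) * mixError N m * ((1 - ε) / 4) := by
        field_simp
        ring
    _ ≤ 344 / (1 - ε) * mixError N m * density K n y z := by gcongr

end Merging

/-! ### Merging times -/

theorem mixError_le_exp_neg (hN : 0 < N) {n : ℕ} {b : ℝ}
    (h : 2 * Real.log N + b ≤ n / (2 * N)) : mixError N n ≤ Real.exp (-b) := by
  have hN' : (0 : ℝ) < N := by exact_mod_cast hN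
  rw [mixError, damping, ← Real.exp_log (pow_pos hN' 2), ← Real.exp_add, Real.log_pow,
    Real.exp_le_exp, neg_div]
  push_cast
  linarith

theorem half_le_log (hN : 2 ≤ N) : 1 / 2 ≤ Real.log N := by
  have : Real.log 2 ≤ Real.log N := Real.log_le_log two_pos (by exact_mod_cast hN)
  linarith [Real.log_two_gt_d9]

theorem exp_neg_posLog_one_div_le {η : ℝ} (hη : 0 < η) :
    Real.exp (-Real.posLog (1 / η)) ≤ η := by
  have h : -Real.log η ≤ Real.posLog (1 / η) := by
    rw [← Real.log_inv, ← one_div]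
    exact le_max_right _ _
  calc Real.exp (-Real.posLog (1 / η)) ≤ Real.exp (Real.log η) :=
        Real.exp_le_exp.2 (neg_le.1 h)
    _ = η := Real.exp_log hη

theorem two_mul_log_add_le_div (hN : 2 ≤ N) {a L : ℝ} (ha : 0 ≤ a) (hL : 0 ≤ L) {n : ℕ}
    (hn : 12 * (2 + a) * N * (Real.log N + L) ≤ n) :
    2 * Real.log N + (a + L) ≤ (n / 3 : ℕ) / (2 * N) := by
  have hN2 : (2 : ℝ) ≤ N := by exact_mod_cast hN
  have hlog := half_le_log hN
  have hfloor : (n : ℝ) ≤ 3 * (n / 3 : ℕ) + 2 := by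
    exact_mod_cast (by lia : n ≤ 3 * (n / 3) + 2)
  have hbudget : 2 * Real.log N + (a + L) + 1 ≤ 2 * (2 + a) * (Real.log N + L) := by
    linarith [mul_nonneg ha hL, mul_nonneg ha (sub_nonneg.2 hlog)]
  have hscaled := mul_le_mul_of_nonneg_right hbudget (by linarith : (0 : ℝ) ≤ 6 * N)
  rw [le_div_iff₀ (by linarith)]
  linarith

theorem exists_maxRelDev_le {ε : ℝ} (hε : ε ∈ Set.Ico 0 1) :
    ∃ D : ℝ, 0 < D ∧ ∀ N : ℕ, 2 ≤ N → ∀ K : ℕ → Matrix (Cube N) (Cube N) ℝ,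
      (∀ i, 1 ≤ i → K i ∈ lazyFamily N ε) → ∀ η : ℝ, 0 < η → ∀ n : ℕ,
        D * N * (Real.log N + Real.posLog (1 / η)) ≤ n →
          maxRelDev K n ≤ ENNReal.ofReal η := by
  have hε1 : 0 < 1 - ε := sub_pos.2 hε.2
  have h344 : 344 ≤ 344 / (1 - ε) := by
    rw [le_div_iff₀ hε1]
    linarith [hε.1]
  have ha : 0 ≤ Real.log (344 / (1 - ε)) := Real.log_nonneg (by linarith)
  refine ⟨12 * (2 + Real.log (344 / (1 - ε))), by linarith, fun N hN K hK η hη n hn => ?_⟩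
  have hL := Real.posLog_nonneg (x := 1 / η)
  have hmix : mixError N (n / 3) ≤ (344 / (1 - ε))⁻¹ * Real.exp (-Real.posLog (1 / η)) := by
    refine (mixError_le_exp_neg (by lia) (two_mul_log_add_le_div hN ha hL hn)).trans_eq ?_
    rw [neg_add, Real.exp_add, Real.exp_neg (Real.log _), Real.exp_log (by linarith)]
  rw [← div_eq_inv_mul, le_div_iff₀' (by linarith)] at hmix
  have hsmall : mixError N (n / 3) ≤ 1 / 40 := by
    have hexp : Real.exp (-Real.posLog (1 / η)) ≤ 1 := Real.exp_le_one_iff.2 (neg_nonpos.2 hL)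
    linarith [mul_le_mul_of_nonneg_right h344 (mixError_nonneg N (n / 3))]
  exact (maxRelDev_le_mixError (by lia) hε hK hsmall (Nat.mul_div_le n 3)).trans
    (ENNReal.ofReal_le_ofReal (hmix.trans (exp_neg_posLog_one_div_le hη)))

theorem one_le_mul_log_add (hN : 2 ≤ N) {L : ℝ} (hL : 0 ≤ L) : 1 ≤ N * (Real.log N + L) := by
  have hN2 : (2 : ℝ) ≤ N := by exact_mod_cast hN
  calc (1 : ℝ) = 2 * (1 / 2) := by norm_num
    _ ≤ N * (Real.log N + L) := by
        gcongr
        linarith [half_le_log hN]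

theorem posLog_one_div_half_le (hN : 2 ≤ N) (η : ℝ) :
    Real.posLog (1 / (η / 2)) ≤ Real.log N + Real.posLog (1 / η) := by
  have hlog : Real.posLog 2 ≤ Real.log N := by
    rw [Real.posLog_eq_log (by norm_num)]
    exact Real.log_le_log two_pos (by exact_mod_cast hN)
  calc Real.posLog (1 / (η / 2)) = Real.posLog (2 * (1 / η)) := by
        rw [one_div_div, mul_one_div]
    _ ≤ Real.posLog 2 + Real.posLog (1 / η) := Real.posLog_mul
    _ ≤ Real.log N + Real.posLog (1 / η) := by gcongr

theorem ceil_le_two_mul_add_one_mul (hN : 2 ≤ N) {D : ℝ} (hD : 0 < D) (η : ℝ) :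
    (⌈D * N * (Real.log N + Real.posLog (1 / (η / 2)))⌉₊ : ℝ) ≤
      (2 * D + 1) * N * (Real.log N + Real.posLog (1 / η)) := by
  have hnonneg : ∀ u, 0 ≤ Real.log N + Real.posLog u := fun u =>
    add_nonneg (Real.log_natCast_nonneg N) Real.posLog_nonneg
  have hhalf := posLog_one_div_half_le hN η
  calc (⌈D * N * (Real.log N + Real.posLog (1 / (η / 2)))⌉₊ : ℝ)
      ≤ D * N * (Real.log N + Real.posLog (1 / (η / 2))) + 1 :=
        (Nat.ceil_lt_add_one (mul_nonneg (by positivity) (hnonneg _))).le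
    _ ≤ D * N * (2 * (Real.log N + Real.posLog (1 / η))) +
          N * (Real.log N + Real.posLog (1 / η)) := by
        gcongr
        · linarith [Real.posLog_nonneg (x := 1 / η)]
        · exact one_le_mul_log_add hN Real.posLog_nonneg
    _ = (2 * D + 1) * N * (Real.log N + Real.posLog (1 / η)) := by ring

end InhomMerging

theorem theorem4p5 (ε : ℝ) (hε : ε ∈ Set.Ioo (0 : ℝ) 1) :
    ∃ D : ℝ, 0 < D ∧
      ∀ (N : ℕ), 2 ≤ N →
      ∀ K : ℕ → Matrix (InhomMerging.Cube N) (InhomMerging.Cube N) ℝ,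
        (∀ i : ℕ, 1 ≤ i → K i ∈ InhomMerging.lazyFamily N ε) →
      ∀ η : ℝ, 0 < η →
        ((InhomMerging.tvMergingTime K η : ℕ∞) : ENNReal) ≤
            ENNReal.ofReal (D * N * (Real.log N + Real.posLog (1 / η))) ∧
        ∀ n : ℕ, D * N * (Real.log N + Real.posLog (1 / η)) ≤ (n : ℝ) →
          InhomMerging.maxRelDev K n ≤ ENNReal.ofReal η := by
  obtain ⟨D, hD, hmerge⟩ := InhomMerging.exists_maxRelDev_le ⟨hε.1.le, hε.2⟩
  refine ⟨2 * D + 1, by linarith, fun N hN K hK η hη => ⟨?_, fun n hn => ?_⟩⟩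
  · have hη2 : 0 < η / 2 := half_pos hη
    have hrow := fun i hi =>
      InhomMerging.mem_rowStochastic_of_mem_lazyFamily (by lia) hε.2.le (hK i hi)
    have hTV := InhomMerging.maxTV_le_of_maxRelDev_le hrow hη2.le
      (hmerge N hN K hK (η / 2) hη2 _ (Nat.le_ceil _))
    exact InhomMerging.tvMergingTime_le (hTV.trans_lt (half_lt_self hη))
      (InhomMerging.ceil_le_two_mul_add_one_mul hN hD η)
  · refine hmerge N hN K hK η hη n (le_trans ?_ hn)
    have hlog : 0 ≤ Real.log N + Real.posLog (1 / η) :=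
      add_nonneg (Real.log_natCast_nonneg N) Real.posLog_nonneg
    gcongr
    linarith
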